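/- **Setting.** Write $\mathcal D$ for the space of complex-valued smooth compactly supported functions on $\mathbb R^d$, $\mathcal D'$ for the space of distributions, and $\mathcal D(K)$ for the $\varphi\in\mathcal D$ with support in the compact set $K$. For $\phi\in\mathcal D$ and $j\in\mathbb N=\{0,1,2,\dots\}$ put $\phi_j=2^{jd}\phi(2^j\,\cdot\,)$. For $f\in\mathcal D'$ and $\phi\in\mathcal D$, $f*\phi$ is the smooth function $x\mapsto\langle f,\phi(x-\cdot)\rangle$. Let $T_xf=f(\cdot-x)$. A *solid translation-invariant Banach function space (TIBF) of bounded type* is a non-trivial Banach space $E$ with continuous inclusion $E\subseteq L^1_{\rm loc}(\mathbb R^d)$ such that: $T_xE\subseteq E$ for all $x\in\mathbb R^d$; there is $C_0>0$ with $\|T_xf\|_E\le C_0\|f\|_E$ for all $x\in\mathbb R^d$, $f\in E$; $E*C_{\rm c}(\mathbb R^d)\subseteq E$; and, if $f\in E$, $g\in L^1_{\rm loc}(\mathbb R^d)$ and $|g|\le|f|$ almost everywhere, then $g\in E$ and $\|g\|_E\le\|f\|_E$. A *weight function system* is a sequence $\mathcal W=(w_n)_{n\in\mathbb N}$ of locally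 bounded measurable functions $w_n:\mathbb R^d\to[1,\infty)$ with $w_n\le w_{n+1}$ for all $n$. It satisfies $(\mathrm{wM})$ if for every $n$ there are $m\ge n$ and $C>0$ with $w_n(x+y)\le C\,w_m(x)$ for all $x\in\mathbb R^d$ and $|y|\le1$. Put $$E^n_{w_n}=\{f\in C^n(\mathbb R^d): f^{(\alpha)}w_n\in E\text{ for all }|\alpha|\le n\},\qquad \|f\|_{E^n_{w_n}}=\max_{|\alpha|\le n}\|f^{(\alpha)}w_n\|_E,$$ and $E^\infty_{\mathcal W}=\bigcap_{n\in\mathbb N}E^n_{w_n}$ with the projective limit topology (that is, the locally convex topology given by the norms $\|\cdot\|_{E^n_{w_n}}$, $n\in\mathbb N$). For $L\in\mathbb N$ let $\mathcal D_L(K)$ be the set of all $\varphi\in\mathcal D(K)$ with $\int x^\alpha\varphi(x)\,dx=0$ for all $|\alpha|<L$. A pair $(\chi^0,\chi^1)\in\mathcal D\times\mathcal D$ has the *moment-wise decomposition factorization property (MDFP)* if there is a compact $K\subset\mathbb R^d$ with non-empty interior such that for every $L\in\mathbb N$ there are non-trivial pairs $(\varphi^\ell_L,\psi^\ell_L)\in\mathcal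 D(K)\times\mathcal D_L(K)$, $\ell\in\{0,1\}$, with $$2^d\varphi^0_L(2\,\cdot\,)-\varphi^0_L=\Delta\psi^0_L,\qquad \int\varphi^0_L(x)\,dx=1,$$ $$\varphi^0_L=\chi^0*\varphi^0_L+\chi^1*\varphi^1_L,\qquad \psi^0_L=\chi^0*\psi^0_L+\chi^1*\psi^1_L.$$ **Theorem.** Let $E$ be a solid TIBF of bounded type, let $\mathcal W$ be a weight function system satisfying $(\mathrm{wM})$, and let $(\chi^0,\chi^1)\in\mathcal D\times\mathcal D$ have the MDFP. Then for every $f\in\mathcal D'$ the following are equivalent: (i) $f\in E^\infty_{\mathcal W}$; (ii) for every $\phi\in\mathcal D$ the set $\{f*\phi_j: j\in\mathbb N\}$ is bounded in $E^\infty_{\mathcal W}$; (iii) for every $\phi\in\mathcal D$ there is $r>0$ such that $\{2^{-rj}(f*\phi_j): j\in\mathbb N\}$ is bounded in $E^\infty_{\mathcal W}$; (iv) there is $r>0$ such that $\{2^{-rj}(f*\chi^\ell_j): j\in\mathbb N,\ \ell\in\{0,1\}\}$ is bounded in $E^\infty_{\mathcal W}$. -/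

import Mathlib

open MeasureTheory Set
open scoped Distributions Laplacian

noncomputable section

/-- The Euclidean space `ℝ^d`. -/
abbrev Rn (d : ℕ) : Type := EuclideanSpace ℝ (Fin d)

/-- `𝓓`: the complex-valued smooth functions with compact support on `ℝ^d`, with Mathlib's
canonical (LF) topology. -/
abbrev TestFn (d : ℕ) : Type := 𝓓((⊤ : TopologicalSpace.Opens (Rn d)), ℂ)

/-- `𝓓'`: the continuous `ℂ`-linear functionals on `𝓓`. -/
abbrev Distr (d : ℕ) : Type := TestFn d →L[ℂ] ℂ

/-! ### Solid translation-invariant Banach function spaces of bounded type -/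

/-- The structure of a solid translation-invariant Banach function space of bounded type on `ℝ^d`
on the normed space `B` (completeness of `B` is the separate type class `CompleteSpace B`).
The inclusion of `B` into the space of (a.e. classes of) measurable functions is `incl`. -/
structure SolidTIBF (d : ℕ) (B : Type*) [NormedAddCommGroup B] [NormedSpace ℂ B] where
  /-- the inclusion of the space into the a.e. classes of functions -/
  incl : B →ₗ[ℂ] (Rn d →ₘ[volume] ℂ)
  incl_injective : Function.Injective incl
  /-- the space is not `{0}` -/
  nontrivial : Nontrivial B
  /-- the elements are locally integrable -/
  locallyIntegrable : ∀ f : B, LocallyIntegrable (incl f) volume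
  /-- the inclusion into `L^1_loc` is continuous -/
  continuous_incl : ∀ K : Set (Rn d), IsCompact K →
    ∃ C : ℝ, ∀ f : B, ∫ x in K, ‖incl f x‖ ≤ C * ‖f‖
  /-- invariance under translations -/
  translate : ∀ (x : Rn d) (f : B), ∃ g : B, incl g =ᵐ[volume] fun t => incl f (t - x)
  /-- uniform boundedness of translations -/
  translate_bound : ∃ C₀ : ℝ, 0 < C₀ ∧ ∀ (x : Rn d) (f g : B),
    (incl g =ᵐ[volume] fun t => incl f (t - x)) → ‖g‖ ≤ C₀ * ‖f‖
  /-- stability under convolution with continuous functions of compact support -/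
  conv : ∀ (f : B) (ψ : Rn d → ℂ), Continuous ψ → HasCompactSupport ψ →
    ∃ g : B, incl g =ᵐ[volume] convolution (incl f) ψ (ContinuousLinearMap.mul ℂ ℂ) volume
  /-- solidity -/
  solid : ∀ (f : B) (g : Rn d → ℂ), LocallyIntegrable g volume →
    (∀ᵐ x ∂volume, ‖g x‖ ≤ ‖incl f x‖) → ∃ h : B, incl h =ᵐ[volume] g ∧ ‖h‖ ≤ ‖f‖

/-- The function `g` belongs to the function space `E`. -/
def SolidTIBF.Mem {d : ℕ} {B : Type*} [NormedAddCommGroup B] [NormedSpace ℂ B]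
    (E : SolidTIBF d B) (g : Rn d → ℂ) : Prop :=
  ∃ e : B, E.incl e =ᵐ[volume] g

/-! ### Weight function systems -/

/-- An increasing sequence of locally bounded (Lebesgue) measurable functions `ℝ^d → [1, ∞)`. -/
structure IsWeightSystem {d : ℕ} (w : ℕ → Rn d → ℝ) : Prop where
  aemeasurable : ∀ n, AEMeasurable (w n) volume
  locallyBounded : ∀ n, ∀ K : Set (Rn d), IsCompact K → ∃ C : ℝ, ∀ x ∈ K, w n x ≤ C
  one_le : ∀ n x, 1 ≤ w n x
  mono : ∀ n x, w n x ≤ w (n + 1) x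

/-- The condition (wM). -/
def WeakModerate {d : ℕ} (w : ℕ → Rn d → ℝ) : Prop :=
  ∀ n, ∃ m, n ≤ m ∧ ∃ C : ℝ, 0 < C ∧
    ∀ x y : Rn d, y ∈ Metric.closedBall (0 : Rn d) 1 → w n (x + y) ≤ C * w m x

/-! ### Gelfand-Shilov-type spaces -/

/-- The partial derivative `∂_{i 0} ⋯ ∂_{i (k-1)} f`. As `i` runs through all words of length `k`,
these are all partial derivatives `f^{(α)}` with `|α| = k` (if `f` is of class `C^k`). -/
def partialDeriv {d k : ℕ} (i : Fin k → Fin d) (f : Rn d → ℂ) (x : Rn d) : ℂ :=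
  iteratedFDeriv ℝ k f x (fun l => EuclideanSpace.single (i l) (1 : ℝ))

theorem partialDeriv_add {d k : ℕ} (i : Fin k → Fin d) {f g : Rn d → ℂ}
    (hf : ContDiff ℝ k f) (hg : ContDiff ℝ k g) (x : Rn d) :
    partialDeriv i (f + g) x = partialDeriv i f x + partialDeriv i g x := by
  simp [partialDeriv, iteratedFDeriv_add hf hg]

theorem partialDeriv_smul {d k : ℕ} (i : Fin k → Fin d) (c : ℂ) {f : Rn d → ℂ}
    (hf : ContDiff ℝ k f) (x : Rn d) :
    partialDeriv i (c • f) x = c * partialDeriv i f x := by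
  simp [partialDeriv, iteratedFDeriv_const_smul_apply hf.contDiffAt]

section Spaces

variable {d : ℕ} {B : Type*} [NormedAddCommGroup B] [NormedSpace ℂ B]

/-- The space `E^n_ω` of all `f ∈ C^n` such that `f^{(α)} ω ∈ E` for all `|α| ≤ n`. -/
def weightedSpace (E : SolidTIBF d B) (ω : Rn d → ℝ) (n : ℕ) : Submodule ℂ (Rn d → ℂ) where
  carrier := {f | ContDiff ℝ n f ∧ ∀ k ≤ n, ∀ i : Fin k → Fin d,
    E.Mem (fun x => partialDeriv i f x * (ω x : ℂ))}
  add_mem' := by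
    rintro f g ⟨hf, hf'⟩ ⟨hg, hg'⟩
    refine ⟨hf.add hg, fun k hk i => ?_⟩
    obtain ⟨a, ha⟩ := hf' k hk i
    obtain ⟨b, hb⟩ := hg' k hk i
    refine ⟨a + b, ?_⟩
    rw [map_add]
    filter_upwards [AEEqFun.coeFn_add (E.incl a) (E.incl b), ha, hb] with x h1 h2 h3
    rw [h1, Pi.add_apply, h2, h3, partialDeriv_add i (hf.of_le (by exact_mod_cast hk))
      (hg.of_le (by exact_mod_cast hk)), add_mul]
  zero_mem' := by
    refine ⟨contDiff_zero_fun, fun k _ i => ⟨0, ?_⟩⟩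
    rw [map_zero]
    filter_upwards [AEEqFun.coeFn_zero (α := Rn d) (β := ℂ) (μ := volume)] with x h1
    rw [h1]
    have h0 : partialDeriv i (0 : Rn d → ℂ) x = 0 := by
      simpa using partialDeriv_smul i 0 (f := (0 : Rn d → ℂ)) contDiff_zero_fun x
    simp [h0]
  smul_mem' := by
    rintro c f ⟨hf, hf'⟩
    refine ⟨contDiff_const.smul hf, fun k hk i => ?_⟩
    obtain ⟨a, ha⟩ := hf' k hk i
    refine ⟨c • a, ?_⟩
    rw [map_smul]
    filter_upwards [AEEqFun.coeFn_smul c (E.incl a), ha] with x h1 h2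
    rw [h1, Pi.smul_apply, h2, partialDeriv_smul i c (hf.of_le (by exact_mod_cast hk)),
      smul_eq_mul, mul_assoc]

/-- The linear map `E^n_ω → E`, `f ↦ f^{(α)} ω`, for `|α| ≤ n`. -/
def weightedDeriv (E : SolidTIBF d B) (ω : Rn d → ℝ) (n : ℕ)
    (i : Σ k : Fin (n + 1), (Fin k → Fin d)) : weightedSpace E ω n →ₗ[ℂ] B where
  toFun f := (f.2.2 i.1 (Nat.lt_succ_iff.mp i.1.2) i.2).choose
  map_add' f g := by
    have hi : (i.1 : ℕ) ≤ n := Nat.lt_succ_iff.mp i.1.2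
    apply E.incl_injective
    rw [map_add]
    refine AEEqFun.ext ?_
    filter_upwards [((f + g).2.2 i.1 hi i.2).choose_spec, (f.2.2 i.1 hi i.2).choose_spec,
      (g.2.2 i.1 hi i.2).choose_spec,
      AEEqFun.coeFn_add (E.incl (f.2.2 i.1 hi i.2).choose) (E.incl (g.2.2 i.1 hi i.2).choose)]
      with x h1 h2 h3 h4
    rw [h1, h4, Pi.add_apply, h2, h3, Submodule.coe_add,
      partialDeriv_add i.2 (f.2.1.of_le (by exact_mod_cast hi))
        (g.2.1.of_le (by exact_mod_cast hi)), add_mul]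
  map_smul' c f := by
    have hi : (i.1 : ℕ) ≤ n := Nat.lt_succ_iff.mp i.1.2
    apply E.incl_injective
    rw [map_smul, RingHom.id_apply]
    refine AEEqFun.ext ?_
    filter_upwards [((c • f).2.2 i.1 hi i.2).choose_spec, (f.2.2 i.1 hi i.2).choose_spec,
      AEEqFun.coeFn_smul c (E.incl (f.2.2 i.1 hi i.2).choose)] with x h1 h2 h3
    rw [h1, h3, Pi.smul_apply, h2, Submodule.coe_smul,
      partialDeriv_smul i.2 c (f.2.1.of_le (by exact_mod_cast hi)), smul_eq_mul, mul_assoc]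

/-- The characterizing property of `weightedDeriv`. -/
theorem incl_weightedDeriv (E : SolidTIBF d B) (ω : Rn d → ℝ) (n : ℕ)
    (i : Σ k : Fin (n + 1), (Fin k → Fin d)) (f : weightedSpace E ω n) :
    E.incl (weightedDeriv E ω n i f) =ᵐ[volume]
      fun x => partialDeriv i.2 (f : Rn d → ℂ) x * (ω x : ℂ) :=
  (f.2.2 i.1 (Nat.lt_succ_iff.mp i.1.2) i.2).choose_spec

/-- The norm `max_{|α| ≤ n} ‖f^{(α)} ω‖_E` of `E^n_ω`. -/
def weightedNorm (E : SolidTIBF d B) (ω : Rn d → ℝ) (n : ℕ) :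
    Seminorm ℂ (weightedSpace E ω n) :=
  Finset.univ.sup fun i => (normSeminorm ℂ B).comp (weightedDeriv E ω n i)

/-- The space `E^∞_W`, the intersection of the spaces `E^n_{w_n}`. -/
def gelfandShilov (E : SolidTIBF d B) (w : ℕ → Rn d → ℝ) : Submodule ℂ (Rn d → ℂ) :=
  ⨅ n, weightedSpace E (w n) n

/-- The norms of `E^n_{w_n}`, `n ∈ ℕ`, on `E^∞_W`. -/
def gelfandShilovNorms (E : SolidTIBF d B) (w : ℕ → Rn d → ℝ) :
    SeminormFamily ℂ (gelfandShilov E w) ℕ := fun n =>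
  (weightedNorm E (w n) n).comp
    (Submodule.inclusion (iInf_le (fun n => weightedSpace E (w n) n) n))

/-- The locally convex (projective limit) topology of `E^∞_W`, given by the norms of all
`E^n_{w_n}`. -/
@[reducible] def gelfandShilovTopology (E : SolidTIBF d B) (w : ℕ → Rn d → ℝ) :
    TopologicalSpace (gelfandShilov E w) :=
  (gelfandShilovNorms E w).moduleFilterBasis.topology

/-- The set `S` of functions is a bounded subset of the topological vector space `E^∞_W`. -/
def BoundedInGS (E : SolidTIBF d B) (w : ℕ → Rn d → ℝ) (S : Set (Rn d → ℂ)) : Prop :=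
  S ⊆ gelfandShilov E w ∧
    @Bornology.IsVonNBounded ℂ (gelfandShilov E w) _ _ _ (gelfandShilovTopology E w)
      {g | (g : Rn d → ℂ) ∈ S}

/-- The distribution `f` is (given by integration against) an element of `E^∞_W`. -/
def DistrMemGS (E : SolidTIBF d B) (w : ℕ → Rn d → ℝ) (f : Distr d) : Prop :=
  ∃ g ∈ gelfandShilov E w, ∀ φ : TestFn d, f φ = ∫ x, g x * φ x

end Spaces

/-! ### Operations on test functions and distributions -/

/-- The test function `y ↦ φ (x - y)`. -/
def reflTranslate {d : ℕ} (φ : TestFn d) (x : Rn d) : TestFn d where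
  toFun y := φ (x - y)
  contDiff' := φ.contDiff.comp (contDiff_const.sub contDiff_id)
  hasCompactSupport' := φ.hasCompactSupport.comp_homeomorph (Homeomorph.subLeft x)
  tsupport_subset' := fun _ _ => trivial

/-- The convolution `f * φ`, that is, `(f * φ) x = ⟨f, φ (x - ·)⟩`. -/
def distrConv {d : ℕ} (f : Distr d) (φ : TestFn d) : Rn d → ℂ :=
  fun x => f (reflTranslate φ x)

/-- The scaled test function `φ_j = 2^{jd} φ(2^j ·)`. -/
def dilate {d : ℕ} (j : ℕ) (φ : TestFn d) : TestFn d where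
  toFun x := (2 : ℂ) ^ (j * d) * φ ((2 : ℝ) ^ j • x)
  contDiff' := contDiff_const.mul (φ.contDiff.comp (contDiff_const_smul _))
  hasCompactSupport' :=
    (φ.hasCompactSupport.comp_homeomorph
      (Homeomorph.smulOfNeZero ((2 : ℝ) ^ j) (by positivity))).mul_left
  tsupport_subset' := fun _ _ => trivial

/-- The convolution of two test functions, as a function. -/
def testConv {d : ℕ} (φ ψ : TestFn d) : Rn d → ℂ :=
  convolution φ ψ (ContinuousLinearMap.mul ℂ ℂ) volume

/-- `∫ x^α φ(x) dx = 0` for all multi-indices `α` with `|α| < L`. -/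
def VanishingMoments {d : ℕ} (L : ℕ) (φ : TestFn d) : Prop :=
  ∀ α : Fin d → ℕ, ∑ i, α i < L → ∫ x : Rn d, (∏ i, (x i : ℂ) ^ α i) * φ x = 0

/-- The moment-wise decomposition factorization property (MDFP) of the pair `(χ 0, χ 1)`. -/
def HasMDFP {d : ℕ} (χ : Fin 2 → TestFn d) : Prop :=
  ∃ K : Set (Rn d), IsCompact K ∧ (interior K).Nonempty ∧
    ∀ L : ℕ, ∃ φ ψ : Fin 2 → TestFn d,
      (∀ l, tsupport (φ l) ⊆ K ∧ tsupport (ψ l) ⊆ K ∧ VanishingMoments L (ψ l) ∧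
        (φ l, ψ l) ≠ (0, 0)) ∧
      (∀ x : Rn d, (2 : ℂ) ^ d * φ 0 ((2 : ℝ) • x) - φ 0 x = (Δ (ψ 0 : Rn d → ℂ)) x) ∧
      (∫ x, φ 0 x = 1) ∧
      (φ 0 : Rn d → ℂ) = testConv (χ 0) (φ 0) + testConv (χ 1) (φ 1) ∧
      (ψ 0 : Rn d → ℂ) = testConv (χ 0) (ψ 0) + testConv (χ 1) (ψ 1)

end

/-!
Throughout, `φ_j` stands for `dilate j φ`, and boundedness in `E^∞_W` is measured by `GSBound`.

*Local suprema stay in `E`.* If all derivatives of `u` up to a sufficiently high order, multiplied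
by a sufficiently large weight of the system, belong to `E`, then
`x ↦ w_n(x) sup_{|t| ≤ R} |u(x - t)|` is dominated by an element of `E`
(`exists_dominating_of_gsBound`). A local Sobolev inequality with `L¹` norms bounds the supremum by
local averages of derivatives, (wM) moves the weight into these averages, and a local average is at
most a convolution of the modulus with a bump function, which is a bounded operator on `E` by the
closed graph theorem (`SolidTIBF.exists_convolution_bound`). Solidity takes care of the rest.

*Convolution with dilated test functions.* Consequently `u ↦ u * ψ_j` is continuous on `E^∞_W`
uniformly in `j`; if the moments of `ψ` of order less than `L` vanish, Taylor's formula gives the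
better bound `2^{-jL}` (`exists_gsBound_convolution_dilate`). With `L = 0` this shows that the
regularizations `f * φ_j` of an element `f` of `E^∞_W` are bounded. Passing from bounded
regularizations to polynomially growing ones, and from all `φ` to the two functions `χ^ℓ`, is only
a matter of scalar factors.

*Reconstruction.* Conversely, suppose that `f * χ^ℓ_j` grows at most like `2^{rj}`, and take `φ^ℓ`,
`ψ^ℓ` from the MDFP with `L ≥ r + 1`. As `∫ φ⁰ = 1`, the regularizations `f * φ⁰_j` converge to `f`
as distributions, so that `f` is the sum of the telescoping series
`f * φ⁰_0 + ∑_j (f * φ⁰_{j+1} - f * φ⁰_j)`. Here `φ⁰_{j+1} - φ⁰_j = (Δψ⁰)_j`, and the factorization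
of `ψ⁰` gives `f * (Δψ⁰)_j = ∑_ℓ (f * χ^ℓ_j) * (Δψ^ℓ)_j`, which is `O(2^{rj} 2^{-jL}) = O(2^{-j})`
in each of the norms. Hence the series converges absolutely in `E^∞_W`, and uniformly, and its
sum is `f` (`distrMemGS_of_boundedInGS`).

The identities `f * (χ * φ) = (f * χ) * φ` and `⟨f * φ, η⟩ = ⟨f, φ^∨ * η⟩` for a distribution `f`
rest on interchanging `f` with an integral of test functions (`apply_testConvolution`). Since
Bochner integrals need a Banach space, `f` is first extended, by the Hahn-Banach theorem, from the
test functions supported in a compact set to a Banach space of jets (`exists_functional_jet`).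
-/

noncomputable section

open scoped ContDiff Convolution

/-! ### Iterated partial derivatives -/

/-- The partial derivative `∂_a u`. -/
def coordDeriv {d : ℕ} (a : Fin d) (u : Rn d → ℂ) (x : Rn d) : ℂ :=
  fderiv ℝ u x (EuclideanSpace.single a 1)

/-- The iterated partial derivative along a word, written as a list of coordinate indices; unlike
`partialDeriv` it can be split along concatenation of words without casts. -/
def listDeriv {d : ℕ} : List (Fin d) → (Rn d → ℂ) → Rn d → ℂ
  | [], u => u
  | a :: l, u => coordDeriv a (listDeriv l u)

section Derivatives

variable {d : ℕ}

@[simp] theorem listDeriv_nil (u : Rn d → ℂ) : listDeriv [] u = u := rfl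

@[simp] theorem listDeriv_cons (a : Fin d) (l : List (Fin d)) (u : Rn d → ℂ) :
    listDeriv (a :: l) u = coordDeriv a (listDeriv l u) := rfl

theorem listDeriv_append (l l' : List (Fin d)) (u : Rn d → ℂ) :
    listDeriv (l ++ l') u = listDeriv l (listDeriv l' u) := by
  induction l with
  | nil => rfl
  | cons a l ih => simp [ih]

theorem contDiff_coordDeriv {u : Rn d → ℂ} (hu : ContDiff ℝ ∞ u) (a : Fin d) :
    ContDiff ℝ ∞ (coordDeriv a u) :=
  (hu.fderiv_right (m := ∞) (by simp)).clm_apply contDiff_const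

theorem contDiff_listDeriv {u : Rn d → ℂ} (hu : ContDiff ℝ ∞ u) (l : List (Fin d)) :
    ContDiff ℝ ∞ (listDeriv l u) := by
  induction l with
  | nil => exact hu
  | cons a l ih => exact contDiff_coordDeriv ih a

theorem hasCompactSupport_coordDeriv {u : Rn d → ℂ} (hu : HasCompactSupport u) (a : Fin d) :
    HasCompactSupport (coordDeriv a u) :=
  hu.fderiv_apply (𝕜 := ℝ) (v := EuclideanSpace.single a 1)

theorem hasCompactSupport_listDeriv {u : Rn d → ℂ} (hu : HasCompactSupport u)
    (l : List (Fin d)) : HasCompactSupport (listDeriv l u) := by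
  induction l with
  | nil => exact hu
  | cons a l ih => exact hasCompactSupport_coordDeriv ih a

theorem coordDeriv_add {u v : Rn d → ℂ} (hu : ContDiff ℝ ∞ u) (hv : ContDiff ℝ ∞ v) (a : Fin d) :
    coordDeriv a (u + v) = coordDeriv a u + coordDeriv a v := by
  ext x
  simp [coordDeriv, fderiv_add (hu.differentiable (by simp) x) (hv.differentiable (by simp) x)]

theorem listDeriv_add {u v : Rn d → ℂ} (hu : ContDiff ℝ ∞ u) (hv : ContDiff ℝ ∞ v)
    (l : List (Fin d)) : listDeriv l (u + v) = listDeriv l u + listDeriv l v := by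
  induction l with
  | nil => rfl
  | cons a l ih =>
    simp only [listDeriv_cons, ih,
      coordDeriv_add (contDiff_listDeriv hu l) (contDiff_listDeriv hv l)]

theorem listDeriv_smul (c : ℂ) {u : Rn d → ℂ} (hu : ContDiff ℝ ∞ u)
    (l : List (Fin d)) : listDeriv l (c • u) = c • listDeriv l u := by
  induction l with
  | nil => rfl
  | cons a l ih =>
    ext x
    simp [listDeriv_cons, ih, coordDeriv,
      fderiv_const_smul ((contDiff_listDeriv hu l).differentiable (by simp) x)]

theorem partialDeriv_cons {k : ℕ} {u : Rn d → ℂ} (hu : ContDiff ℝ ∞ u) (i : Fin (k + 1) → Fin d) :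
    partialDeriv i u = coordDeriv (i 0) (partialDeriv (Fin.tail i) u) := by
  ext x
  have hd : DifferentiableAt ℝ (iteratedFDeriv ℝ k u) x :=
    (hu.differentiable_iteratedFDeriv (m := k) (by exact_mod_cast ENat.natCast_lt_top k)) x
  unfold partialDeriv coordDeriv
  rw [iteratedFDeriv_succ_apply_left, ← fderiv_continuousMultilinear_apply_const_apply hd]
  rfl

theorem partialDeriv_eq_listDeriv {k : ℕ} {u : Rn d → ℂ} (hu : ContDiff ℝ ∞ u)
    (i : Fin k → Fin d) : partialDeriv i u = listDeriv (List.ofFn i) u := by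
  induction k with
  | zero => ext x; simp [partialDeriv]
  | succ k ih => rw [partialDeriv_cons hu, ih, List.ofFn_succ, listDeriv_cons]; rfl

/-- Expansion of an iterated derivative in the standard basis. -/
theorem iteratedFDeriv_apply_eq_sum (k : ℕ) (u : Rn d → ℂ) (x : Rn d) (m : Fin k → Rn d) :
    iteratedFDeriv ℝ k u x m
      = ∑ i : Fin k → Fin d, (∏ l, m l (i l)) • partialDeriv i u x := by
  have hm : m = fun l => ∑ a : Fin d, (m l a) • EuclideanSpace.single a (1 : ℝ) := by
    ext l b
    simp [Finset.sum_apply, Pi.single_apply]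
  conv_lhs => rw [hm]
  rw [(iteratedFDeriv ℝ k u x).map_sum (fun l a => (m l a) • EuclideanSpace.single a (1 : ℝ))]
  refine Finset.sum_congr rfl fun i _ => ?_
  rw [ContinuousMultilinearMap.map_smul_univ]
  rfl

theorem norm_iteratedFDeriv_le_sum (k : ℕ) (u : Rn d → ℂ) (x : Rn d) :
    ‖iteratedFDeriv ℝ k u x‖ ≤ ∑ i : Fin k → Fin d, ‖partialDeriv i u x‖ := by
  refine ContinuousMultilinearMap.opNorm_le_bound (by positivity) fun m => ?_
  rw [iteratedFDeriv_apply_eq_sum, Finset.sum_mul]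
  refine (norm_sum_le _ _).trans (Finset.sum_le_sum fun i _ => ?_)
  rw [norm_smul, mul_comm]
  gcongr
  rw [norm_prod]
  exact Finset.prod_le_prod (fun _ _ => norm_nonneg _) fun l _ => PiLp.norm_apply_le (m l) (i l)

theorem laplacian_eq_sum_listDeriv {u : Rn d → ℂ} (hu : ContDiff ℝ ∞ u) :
    (Δ u) = ∑ a : Fin d, listDeriv [a, a] u := by
  ext x
  rw [InnerProductSpace.laplacian_eq_iteratedFDeriv_orthonormalBasis u
    (EuclideanSpace.basisFun (Fin d) ℝ), Finset.sum_apply]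
  refine Finset.sum_congr rfl fun a _ => ?_
  have : listDeriv [a, a] u = partialDeriv ![a, a] u := by
    rw [partialDeriv_eq_listDeriv hu]; simp
  rw [this, partialDeriv]
  congr 1
  ext l b
  fin_cases l <;> simp

/-! ### Derivatives of convolutions -/

theorem contDiff_convolution {u ψ : Rn d → ℂ} (hu : LocallyIntegrable u)
    (hψ : ContDiff ℝ ∞ ψ) (hc : HasCompactSupport ψ) :
    ContDiff ℝ ∞ (u ⋆[ContinuousLinearMap.mul ℂ ℂ] ψ) :=
  hc.contDiff_convolution_right (ContinuousLinearMap.mul ℝ ℂ) hu hψ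

theorem coordDeriv_convolution_right {u ψ : Rn d → ℂ} (hu : LocallyIntegrable u)
    (hψ : ContDiff ℝ ∞ ψ) (hc : HasCompactSupport ψ) (a : Fin d) :
    coordDeriv a (u ⋆[ContinuousLinearMap.mul ℂ ℂ] ψ)
      = u ⋆[ContinuousLinearMap.mul ℂ ℂ] coordDeriv a ψ := by
  ext x
  have h := hc.hasFDerivAt_convolution_right (μ := volume) (ContinuousLinearMap.mul ℝ ℂ) hu
    (hψ.of_le (by simp)) x
  have h' := h.fderiv
  unfold coordDeriv
  change fderiv ℝ (u ⋆[ContinuousLinearMap.mul ℝ ℂ] ψ) x _ = _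
  rw [h', convolution_precompR_apply _ hu (hc.fderiv ℝ) (hψ.continuous_fderiv (by simp))]
  rfl

theorem listDeriv_convolution_right {u ψ : Rn d → ℂ} (hu : LocallyIntegrable u)
    (hψ : ContDiff ℝ ∞ ψ) (hc : HasCompactSupport ψ) (l : List (Fin d)) :
    listDeriv l (u ⋆[ContinuousLinearMap.mul ℂ ℂ] ψ)
      = u ⋆[ContinuousLinearMap.mul ℂ ℂ] listDeriv l ψ := by
  induction l with
  | nil => rfl
  | cons a l ih =>
    rw [listDeriv_cons, ih, coordDeriv_convolution_right hu (contDiff_listDeriv hψ l)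
      (hasCompactSupport_listDeriv hc l)]
    rfl

theorem coordDeriv_convolution_left {u ψ : Rn d → ℂ} (hu : ContDiff ℝ ∞ u)
    (hψ : ContDiff ℝ ∞ ψ) (hc : HasCompactSupport ψ) (a : Fin d) :
    coordDeriv a (u ⋆[ContinuousLinearMap.mul ℂ ℂ] ψ)
      = coordDeriv a u ⋆[ContinuousLinearMap.mul ℂ ℂ] ψ := by
  rw [coordDeriv_convolution_right hu.continuous.locallyIntegrable hψ hc]
  ext x
  simp only [convolution, ContinuousLinearMap.mul_apply']
  have hcx : HasCompactSupport (fun t => ψ (x - t)) := hc.comp_homeomorph (Homeomorph.subLeft x)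
  have hψx : ContDiff ℝ ∞ (fun t => ψ (x - t)) := hψ.comp (contDiff_const.sub contDiff_id)
  have hd : ∀ t, fderiv ℝ (fun t => ψ (x - t)) t (EuclideanSpace.single a 1)
      = -coordDeriv a ψ (x - t) := by
    intro t
    have : HasFDerivAt (fun t => ψ (x - t))
        ((fderiv ℝ ψ (x - t)).comp (-ContinuousLinearMap.id ℝ (Rn d))) t :=
      ((hψ.differentiable (by simp) (x - t)).hasFDerivAt).comp t
        ((hasFDerivAt_id t).const_sub x)
    rw [this.fderiv]
    simp [coordDeriv]
  have hcd : HasCompactSupport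
      (fun t => fderiv ℝ (fun t => ψ (x - t)) t (EuclideanSpace.single a 1)) :=
    hcx.fderiv_apply (𝕜 := ℝ) (v := EuclideanSpace.single a 1)
  have hdc : Continuous
      (fun t => fderiv ℝ (fun t => ψ (x - t)) t (EuclideanSpace.single a 1)) :=
    (hψx.continuous_fderiv (by simp)).clm_apply continuous_const
  have key := integral_mul_fderiv_eq_neg_fderiv_mul_of_integrable (μ := (volume : Measure (Rn d)))
    (f := u) (g := fun t => ψ (x - t)) (v := EuclideanSpace.single a 1)
    (((contDiff_coordDeriv hu a).continuous.mul hψx.continuous).integrable_of_hasCompactSupport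
      hcx.mul_left)
    ((hu.continuous.mul hdc).integrable_of_hasCompactSupport hcd.mul_left)
    ((hu.continuous.mul hψx.continuous).integrable_of_hasCompactSupport hcx.mul_left)
    (fun t _ => hu.differentiable (by simp) t) (fun t _ => hψx.differentiable (by simp) t)
  simp only [hd, mul_neg, integral_neg, neg_inj] at key
  exact key

theorem listDeriv_convolution_left {u ψ : Rn d → ℂ} (hu : ContDiff ℝ ∞ u)
    (hψ : ContDiff ℝ ∞ ψ) (hc : HasCompactSupport ψ) (l : List (Fin d)) :
    listDeriv l (u ⋆[ContinuousLinearMap.mul ℂ ℂ] ψ)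
      = listDeriv l u ⋆[ContinuousLinearMap.mul ℂ ℂ] ψ := by
  induction l with
  | nil => rfl
  | cons a l ih =>
    rw [listDeriv_cons, ih, coordDeriv_convolution_left (contDiff_listDeriv hu l) hψ hc]
    rfl

end Derivatives

/-! ### A local Sobolev inequality -/

section Sobolev

variable {d : ℕ}

open FourierTransform in
/-- Sobolev inequality with `L¹` norms: `d + 1` derivatives in `L¹` make the Fourier transform
decay integrably, and Fourier inversion bounds the function. -/
theorem exists_norm_le_sum_integral_iteratedFDeriv (d : ℕ) :
    ∃ C : ℝ, 0 ≤ C ∧ ∀ g : Rn d → ℂ, ContDiff ℝ ∞ g → HasCompactSupport g → ∀ x,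
      ‖g x‖ ≤ C * ∑ q ∈ Finset.range (d + 2), ∫ y, ‖iteratedFDeriv ℝ q g y‖ := by
  have hint : Integrable (fun w : Rn d => (1 + ‖w‖) ^ (-((d + 1 : ℕ) : ℝ))) :=
    integrable_one_add_norm (by simp)
  refine ⟨2 ^ d * (1 + 2 ^ (d + 1)) * ∫ w : Rn d, (1 + ‖w‖) ^ (-((d + 1 : ℕ) : ℝ)), by positivity,
    fun g hg hc x => ?_⟩
  set S := ∑ q ∈ Finset.range (d + 2), ∫ y, ‖iteratedFDeriv ℝ q g y‖ with hS
  have hcont : ∀ n : ℕ, Continuous (iteratedFDeriv ℝ n g) := fun n =>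
    hg.continuous_iteratedFDeriv (m := n) (by exact_mod_cast le_top)
  have hI : ∀ k n : ℕ, Integrable (fun v : Rn d => ‖v‖ ^ k * ‖iteratedFDeriv ℝ n g v‖) := by
    intro k n
    exact ((continuous_norm.pow k).mul (hcont n).norm).integrable_of_hasCompactSupport
      ((hc.iteratedFDeriv n).norm.mul_left)
  have hgi : Integrable g := hg.continuous.integrable_of_hasCompactSupport hc
  have hF : ∀ n : ℕ, n ≤ d + 1 → ∀ w, ‖w‖ ^ n * ‖𝓕 g w‖ ≤ 2 ^ n * S := by
    intro n hn w
    have := Real.pow_mul_norm_iteratedFDeriv_fourier_le (K := ⊤) (N := ⊤) (f := g) hg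
      (fun k n _ _ => hI k n) (k := 0) (n := n) le_top le_top w
    simp only [norm_iteratedFDeriv_zero, pow_zero, CharP.cast_eq_zero, mul_zero, zero_add,
      one_mul, Finset.range_one, Finset.sum_product, Finset.sum_singleton] at this
    refine this.trans ?_
    gcongr
    refine Finset.sum_le_sum_of_subset_of_nonneg ?_ (fun _ _ _ => by positivity)
    exact Finset.range_subset_range.2 (by omega)
  have hbd : ∀ w, ‖𝓕 g w‖ ≤ 2 ^ d * (1 + 2 ^ (d + 1)) * S * (1 + ‖w‖) ^ (-((d + 1 : ℕ) : ℝ)) := by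
    intro w
    have h0 := hF 0 (by omega) w
    have h1 := hF (d + 1) le_rfl w
    simp only [pow_zero, one_mul] at h0
    have h2 : (1 + ‖w‖) ^ (d + 1) ≤ 2 ^ d * (1 ^ (d + 1) + ‖w‖ ^ (d + 1)) := by
      simpa using add_pow_le zero_le_one (norm_nonneg w) (d + 1)
    rw [Real.rpow_neg (by positivity), Real.rpow_natCast, ← div_eq_mul_inv,
      le_div_iff₀ (by positivity)]
    calc ‖𝓕 g w‖ * (1 + ‖w‖) ^ (d + 1)
        ≤ ‖𝓕 g w‖ * (2 ^ d * (1 ^ (d + 1) + ‖w‖ ^ (d + 1))) := by gcongr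
      _ = 2 ^ d * (‖𝓕 g w‖ + ‖w‖ ^ (d + 1) * ‖𝓕 g w‖) := by ring
      _ ≤ 2 ^ d * (S + 2 ^ (d + 1) * S) := by gcongr
      _ = 2 ^ d * (1 + 2 ^ (d + 1)) * S := by ring
  have hFc : Continuous (𝓕 g) :=
    VectorFourier.fourierIntegral_continuous Real.continuous_fourierChar
      (by exact continuous_inner) hgi
  have hFi : Integrable (𝓕 g) :=
    (hint.const_mul _).mono' hFc.aestronglyMeasurable (Filter.Eventually.of_forall hbd)
  have hinv := congrFun (hg.continuous.fourierInv_fourier_eq hgi hFi) x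
  rw [← hinv, Real.fourierInv_eq']
  refine (norm_integral_le_integral_norm _).trans ?_
  calc _ ≤ ∫ w, 2 ^ d * (1 + 2 ^ (d + 1)) * S * (1 + ‖w‖) ^ (-((d + 1 : ℕ) : ℝ)) := by
        refine integral_mono_of_nonneg (Filter.Eventually.of_forall fun _ => norm_nonneg _)
          (hint.const_mul _) (Filter.Eventually.of_forall fun w => ?_)
        refine le_trans (le_of_eq ?_) (hbd w)
        beta_reduce
        rw [norm_smul]
        have : ‖Complex.exp (↑(2 * Real.pi * inner ℝ w x) * Complex.I)‖ = 1 :=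
          Complex.norm_exp_ofReal_mul_I _
        rw [this, one_mul]
    _ = _ := by rw [integral_const_mul]; ring

/-- Local Sobolev inequality, from the global one and a cut-off function. -/
theorem exists_norm_le_sum_setIntegral_iteratedFDeriv (d : ℕ) :
    ∃ C : ℝ, 0 ≤ C ∧ ∀ v : Rn d → ℂ, ContDiff ℝ ∞ v → ∀ x,
      ‖v x‖ ≤ C * ∑ q ∈ Finset.range (d + 2),
        ∫ y in Metric.closedBall x 1, ‖iteratedFDeriv ℝ q v y‖ := by
  obtain ⟨C, hC, hsob⟩ := exists_norm_le_sum_integral_iteratedFDeriv d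
  let η : ContDiffBump (0 : Rn d) := ⟨1 / 2, 1, by norm_num, by norm_num⟩
  have hη : ContDiff ℝ ∞ η := η.contDiff
  have hA : ∀ i : ℕ, ∃ A : ℝ, ∀ y, ‖iteratedFDeriv ℝ i η y‖ ≤ A := fun i =>
    (hη.continuous_iteratedFDeriv (m := i)
      (by exact_mod_cast le_top)).bounded_above_of_compact_support
      (η.hasCompactSupport.iteratedFDeriv i)
  choose A hA using hA
  have hA0 : ∀ i, 0 ≤ A i := fun i => (norm_nonneg _).trans (hA i 0)
  refine ⟨C * ∑ q ∈ Finset.range (d + 2), ∑ i ∈ Finset.range (q + 1), (q.choose i : ℝ) * A i,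
    mul_nonneg hC (Finset.sum_nonneg fun q _ => Finset.sum_nonneg fun i _ =>
      mul_nonneg (by positivity) (hA0 i)), fun v hv x => ?_⟩
  have hcontv : ∀ n : ℕ, Continuous (iteratedFDeriv ℝ n v) := fun n =>
    hv.continuous_iteratedFDeriv (m := n) (by exact_mod_cast le_top)
  set T := ∑ q ∈ Finset.range (d + 2), ∫ y in Metric.closedBall x 1, ‖iteratedFDeriv ℝ q v y‖
  have hηx : ContDiff ℝ ∞ (fun y => η (y - x)) := hη.comp (contDiff_id.sub contDiff_const)
  have hsx : HasCompactSupport (fun y => η (y - x)) :=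
    η.hasCompactSupport.comp_homeomorph (Homeomorph.subRight x)
  let g : Rn d → ℂ := fun y => η (y - x) • v y
  have hg : ContDiff ℝ ∞ g := hηx.smul hv
  have hgc : HasCompactSupport g := hsx.smul_right
  have hcontg : ∀ n : ℕ, Continuous (iteratedFDeriv ℝ n g) := fun n =>
    hg.continuous_iteratedFDeriv (m := n) (by exact_mod_cast le_top)
  have hts : tsupport g ⊆ Metric.closedBall x 1 := by
    refine closure_minimal (fun y hy => ?_) Metric.isClosed_closedBall
    have : η (y - x) ≠ 0 := by
      intro h
      simp [g, h] at hy
    have h2 : y - x ∈ Metric.ball (0 : Rn d) 1 := by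
      rw [← η.support_eq]
      exact this
    rw [mem_ball_zero_iff] at h2
    rw [mem_closedBall_iff_norm]
    exact h2.le
  have hgx : g x = v x := by
    have : η 0 = 1 := η.one_of_mem_closedBall (by simp [η])
    simp [g, this]
  have hSq : ∀ q ∈ Finset.range (d + 2), ∫ y, ‖iteratedFDeriv ℝ q g y‖
      ≤ (∑ i ∈ Finset.range (q + 1), (q.choose i : ℝ) * A i) * T := by
    intro q hq
    have h1 : ∫ y, ‖iteratedFDeriv ℝ q g y‖
        = ∫ y in Metric.closedBall x 1, ‖iteratedFDeriv ℝ q g y‖ := by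
      symm
      refine setIntegral_eq_integral_of_forall_compl_eq_zero fun y hy => ?_
      rw [norm_eq_zero]
      by_contra h
      exact hy (hts (support_iteratedFDeriv_subset q h))
    have hion : ∀ n, IntegrableOn (fun y => ‖iteratedFDeriv ℝ n v y‖) (Metric.closedBall x 1) :=
      fun n => (hcontv n).norm.continuousOn.integrableOn_compact (isCompact_closedBall x 1)
    rw [h1]
    calc _ ≤ ∫ y in Metric.closedBall x 1,
          ∑ i ∈ Finset.range (q + 1), (q.choose i : ℝ) * A i * ‖iteratedFDeriv ℝ (q - i) v y‖ := by
          refine setIntegral_mono ((hcontg q).norm.continuousOn.integrableOn_compact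
            (isCompact_closedBall x 1)) ?_ fun y => ?_
          · exact integrable_finsetSum _ fun i _ => (hion _).const_mul _
          · refine (norm_iteratedFDeriv_smul_le hηx hv y
              (by exact_mod_cast le_top)).trans ?_
            refine Finset.sum_le_sum fun i _ => ?_
            gcongr
            rw [iteratedFDeriv_comp_sub]
            exact hA i _
      _ = ∑ i ∈ Finset.range (q + 1), (q.choose i : ℝ) * A i *
          ∫ y in Metric.closedBall x 1, ‖iteratedFDeriv ℝ (q - i) v y‖ := by
          rw [integral_finsetSum _ fun i _ => (hion _).const_mul _]
          simp_rw [integral_const_mul]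
      _ ≤ ∑ i ∈ Finset.range (q + 1), (q.choose i : ℝ) * A i * T := by
          refine Finset.sum_le_sum fun i _ => ?_
          have := hA0 i
          gcongr
          refine Finset.single_le_sum (f := fun q => ∫ y in Metric.closedBall x 1,
            ‖iteratedFDeriv ℝ q v y‖) (fun _ _ => by positivity) ?_
          simp only [Finset.mem_range] at hq ⊢
          omega
      _ = _ := by rw [Finset.sum_mul]
  calc ‖v x‖ = ‖g x‖ := by rw [hgx]
    _ ≤ C * ∑ q ∈ Finset.range (d + 2), ∫ y, ‖iteratedFDeriv ℝ q g y‖ := hsob g hg hgc x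
    _ ≤ C * ∑ q ∈ Finset.range (d + 2),
        ((∑ i ∈ Finset.range (q + 1), (q.choose i : ℝ) * A i) * T) := by
        gcongr with q hq; exact hSq q hq
    _ = _ := by rw [← Finset.sum_mul, mul_assoc]

/-- The finite set of words of length at most `N` in the coordinate indices. -/
def wordsUpTo (d N : ℕ) : Finset (List (Fin d)) :=
  (Finset.range (N + 1)).biUnion fun k => Finset.univ.image (List.ofFn (n := k))

theorem length_le_of_mem_wordsUpTo {N : ℕ} {l : List (Fin d)} (h : l ∈ wordsUpTo d N) :
    l.length ≤ N := by
  simp only [wordsUpTo, Finset.mem_biUnion, Finset.mem_range, Finset.mem_image, Finset.mem_univ,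
    true_and] at h
  obtain ⟨k, hk, i, rfl⟩ := h
  simp
  omega

theorem norm_iteratedFDeriv_le_sum_wordsUpTo {k N : ℕ} (hk : k ≤ N) {u : Rn d → ℂ}
    (hu : ContDiff ℝ ∞ u) (x : Rn d) :
    ‖iteratedFDeriv ℝ k u x‖ ≤ ∑ l ∈ wordsUpTo d N, ‖listDeriv l u x‖ := by
  refine (norm_iteratedFDeriv_le_sum k u x).trans ?_
  simp_rw [partialDeriv_eq_listDeriv hu]
  rw [← Finset.sum_image (f := fun l => ‖listDeriv l u x‖) (g := List.ofFn (n := k))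
    (s := Finset.univ) (List.ofFn_injective.injOn)]
  refine Finset.sum_le_sum_of_subset_of_nonneg ?_ fun _ _ _ => norm_nonneg _
  intro l hl
  simp only [wordsUpTo, Finset.mem_biUnion, Finset.mem_range]
  exact ⟨k, by omega, hl⟩

theorem exists_norm_le_sum_setIntegral_listDeriv (d : ℕ) :
    ∃ C : ℝ, 0 ≤ C ∧ ∀ v : Rn d → ℂ, ContDiff ℝ ∞ v → ∀ x,
      ‖v x‖ ≤ C * ∑ l ∈ wordsUpTo d (d + 1),
        ∫ y in Metric.closedBall x 1, ‖listDeriv l v y‖ := by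
  obtain ⟨C, hC, h⟩ := exists_norm_le_sum_setIntegral_iteratedFDeriv d
  refine ⟨C * (d + 2), by positivity, fun v hv x => (h v hv x).trans ?_⟩
  rw [mul_assoc]
  gcongr
  have hion : ∀ l, IntegrableOn (fun y => ‖listDeriv l v y‖) (Metric.closedBall x 1) := fun l =>
    (contDiff_listDeriv hv l).continuous.norm.continuousOn.integrableOn_compact
      (isCompact_closedBall x 1)
  calc _ ≤ ∑ q ∈ Finset.range (d + 2), ∑ l ∈ wordsUpTo d (d + 1),
        ∫ y in Metric.closedBall x 1, ‖listDeriv l v y‖ := by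
        refine Finset.sum_le_sum fun q hq => ?_
        rw [← integral_finsetSum _ fun l _ => hion l]
        refine setIntegral_mono ?_ (integrable_finsetSum _ fun l _ => hion l) fun y =>
          norm_iteratedFDeriv_le_sum_wordsUpTo (by simp at hq; omega) hv y
        exact (hv.continuous_iteratedFDeriv (m := q)
          (by exact_mod_cast le_top)).norm.continuousOn.integrableOn_compact
          (isCompact_closedBall x 1)
    _ = _ := by simp

end Sobolev

/-! ### Distributions and convolution integrals -/

section Distributions

variable {d : ℕ}

/-- The translated test function `y ↦ φ (y - z)`. -/
def translateTest (φ : TestFn d) (z : Rn d) : TestFn d where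
  toFun y := φ (y - z)
  contDiff' := φ.contDiff.comp (contDiff_id.sub contDiff_const)
  hasCompactSupport' := φ.hasCompactSupport.comp_homeomorph (Homeomorph.subRight z)
  tsupport_subset' := fun _ _ => trivial

/-- The convolution of two test functions, as a test function. -/
def testConvolution (φ ψ : TestFn d) : TestFn d where
  toFun := testConv φ ψ
  contDiff' := contDiff_convolution φ.continuous.locallyIntegrable ψ.contDiff ψ.hasCompactSupport
  hasCompactSupport' :=
    HasCompactSupport.convolution (ContinuousLinearMap.mul ℂ ℂ) φ.hasCompactSupport
      ψ.hasCompactSupport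
  tsupport_subset' := fun _ _ => trivial

@[simp] theorem translateTest_apply (φ : TestFn d) (z y : Rn d) :
    translateTest φ z y = φ (y - z) := rfl

@[simp] theorem reflTranslate_apply (φ : TestFn d) (x y : Rn d) :
    reflTranslate φ x y = φ (x - y) := rfl

theorem testConvolution_apply (φ ψ : TestFn d) (y : Rn d) :
    testConvolution φ ψ y = ∫ z, φ z * ψ (y - z) := rfl

/-- The Banach space containing the `N`-jets of test functions, that is, the families of all
their iterated partial derivatives along words of length at most `N`, with the supremum norm. -/
abbrev JetSpace (d N : ℕ) : Type :=
  {l // l ∈ wordsUpTo d N} → BoundedContinuousFunction (Rn d) ℂ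

theorem exists_norm_listDeriv_le {u : Rn d → ℂ} (hu : ContDiff ℝ ∞ u) (hc : HasCompactSupport u)
    (l : List (Fin d)) : ∃ C, ∀ y, ‖listDeriv l u y‖ ≤ C :=
  (contDiff_listDeriv hu l).continuous.bounded_above_of_compact_support
    (hasCompactSupport_listDeriv hc l)

/-- The `N`-jet of a smooth compactly supported function. -/
def jet (N : ℕ) {u : Rn d → ℂ} (hu : ContDiff ℝ ∞ u) (hc : HasCompactSupport u) :
    JetSpace d N := fun l =>
  BoundedContinuousFunction.ofNormedAddCommGroup (listDeriv l.1 u)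
    (contDiff_listDeriv hu l.1).continuous
    (exists_norm_listDeriv_le hu hc l.1).choose (exists_norm_listDeriv_le hu hc l.1).choose_spec

@[simp] theorem jet_apply (N : ℕ) {u : Rn d → ℂ} (hu : ContDiff ℝ ∞ u) (hc : HasCompactSupport u)
    (l : {l // l ∈ wordsUpTo d N}) (y : Rn d) : jet N hu hc l y = listDeriv l.1 u y := rfl

/-- The `N`-jet of a test function. -/
def testJet (N : ℕ) (φ : TestFn d) : JetSpace d N := jet N φ.contDiff φ.hasCompactSupport

theorem nil_mem_wordsUpTo (N : ℕ) : [] ∈ wordsUpTo d N := by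
  simp only [wordsUpTo, Finset.mem_biUnion, Finset.mem_range]
  exact ⟨0, by omega, by simp⟩

/-- On test functions with support in a fixed compact set, a distribution has finite order; by the
Hahn-Banach theorem it extends to a continuous functional on jets. The Banach space of jets makes
Bochner integrals of families of test functions available. -/
theorem exists_functional_jet (f : Distr d) {K : Set (Rn d)} (hK : IsCompact K) :
    ∃ (N : ℕ) (F : JetSpace d N →L[ℂ] ℂ),
      ∀ φ : TestFn d, tsupport φ ⊆ K → F (testJet N φ) = f φ := by
  let K' : TopologicalSpace.Compacts (Rn d) := ⟨K, hK⟩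
  have hK' : (K' : Set (Rn d)) ⊆ (⊤ : TopologicalSpace.Opens (Rn d)) := fun _ _ => trivial
  let T : 𝓓_{K'}(Rn d, ℂ) →L[ℂ] ℂ := f.comp (TestFunction.ofSupportedInCLM ℂ hK')
  obtain ⟨s, C, -, hsC⟩ := Seminorm.bound_of_continuous
    (ContDiffMapSupportedIn.withSeminorms ℂ (Rn d) ℂ ⊤ K')
    ((normSeminorm ℂ ℂ).comp T.toLinearMap) (continuous_norm.comp T.continuous)
  let N := s.sup id
  let ι : 𝓓_{K'}(Rn d, ℂ) →ₗ[ℂ] JetSpace d N :=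
    { toFun := fun φ => jet N φ.contDiff φ.hasCompactSupport
      map_add' := fun φ ψ => by
        funext l
        ext1 y
        exact congrFun (listDeriv_add φ.contDiff ψ.contDiff l.1) y
      map_smul' := fun c φ => by
        funext l
        ext1 y
        exact congrFun (listDeriv_smul c φ.contDiff l.1) y }
  have hι : Function.Injective ι := fun φ ψ h => by
    ext1 y
    exact congrArg (fun v : JetSpace d N => v ⟨[], nil_mem_wordsUpTo N⟩ y) h
  have hbound : ∀ φ, ‖T φ‖ ≤ C * (wordsUpTo d N).card * ‖ι φ‖ := by
    intro φ
    refine (hsC φ).trans ?_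
    change (C : ℝ) * (s.sup (ContDiffMapSupportedIn.seminorm ℂ (Rn d) ℂ ⊤ K')) φ ≤ _
    rw [mul_assoc]
    gcongr
    refine Seminorm.finset_sup_apply_le (by positivity) fun j hj => ?_
    have hjN : j ≤ N := Finset.le_sup (f := id) hj
    rw [ContDiffMapSupportedIn.seminorm_top_le_iff ℂ (by positivity)]
    intro y _
    refine (norm_iteratedFDeriv_le_sum_wordsUpTo hjN φ.contDiff y).trans ?_
    rw [← nsmul_eq_mul]
    refine Finset.sum_le_card_nsmul _ _ _ fun l hl => ?_
    exact ((ι φ ⟨l, hl⟩).norm_coe_le_norm y).trans (norm_le_pi_norm (ι φ) ⟨l, hl⟩)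
  let e := LinearEquiv.ofInjective ι hι
  let g : LinearMap.range ι →L[ℂ] ℂ :=
    (T.toLinearMap ∘ₗ e.symm.toLinearMap).mkContinuous (C * (wordsUpTo d N).card) fun v => by
      have := hbound (e.symm v)
      have h2 : ι (e.symm v) = v := by
        conv_rhs => rw [← e.apply_symm_apply v]
        rfl
      rw [h2] at this
      exact this
  obtain ⟨F, hF, -⟩ := exists_extension_norm_eq _ g
  refine ⟨N, F, fun φ hφ => ?_⟩
  let φK : 𝓓_{K'}(Rn d, ℂ) := ⟨φ, φ.contDiff, fun x hx => by
    by_contra h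
    exact hx (hφ (subset_tsupport _ h))⟩
  have h2 := hF (e φK)
  have h3 : g (e φK) = T φK := by
    change T (e.symm (e φK)) = _
    rw [e.symm_apply_apply]
  rw [show testJet N φ = (e φK : JetSpace d N) from rfl, h2, h3]
  rfl

theorem listDeriv_comp_sub_const (u : Rn d → ℂ) (l : List (Fin d)) (z : Rn d) :
    listDeriv l (fun y => u (y - z)) = fun y => listDeriv l u (y - z) := by
  induction l with
  | nil => rfl
  | cons a l ih =>
    ext y
    rw [listDeriv_cons, ih]
    simp only [coordDeriv, listDeriv_cons, fderiv_comp_sub]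

theorem listDeriv_translateTest (φ : TestFn d) (l : List (Fin d)) (z y : Rn d) :
    listDeriv l (translateTest φ z) y = listDeriv l φ (y - z) :=
  congrFun (listDeriv_comp_sub_const φ l z) y

theorem continuous_testJet_translateTest (N : ℕ) (φ : TestFn d) :
    Continuous fun z => testJet N (translateTest φ z) := by
  refine continuous_pi fun l => ?_
  obtain ⟨C, hC⟩ := ContDiff.lipschitzWith_of_hasCompactSupport
    (hasCompactSupport_listDeriv φ.hasCompactSupport l.1)
    (contDiff_listDeriv φ.contDiff l.1) (by simp)
  refine LipschitzWith.continuous (K := C) (LipschitzWith.of_dist_le_mul fun z z' => ?_)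
  refine (BoundedContinuousFunction.dist_le (by positivity)).2 fun y => ?_
  rw [testJet, testJet, jet_apply, jet_apply, listDeriv_translateTest, listDeriv_translateTest]
  refine (hC.dist_le_mul _ _).trans ?_
  rw [dist_sub_left]

theorem tsupport_translateTest_subset (φ : TestFn d) (z : Rn d) :
    tsupport (translateTest φ z) ⊆ (fun p : Rn d × Rn d => p.1 + p.2) '' ({z} ×ˢ tsupport φ) := by
  refine closure_minimal (fun y hy => ⟨(z, y - z), ⟨rfl, subset_tsupport _ hy⟩, by simp⟩) ?_
  exact ((isCompact_singleton.prod φ.hasCompactSupport).image continuous_add).isClosed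

theorem exists_functional_testJet_translateTest (f : Distr d) (φ : TestFn d) {K : Set (Rn d)}
    (hK : IsCompact K) :
    ∃ (N : ℕ) (F : JetSpace d N →L[ℂ] ℂ), (∀ z ∈ K, F (testJet N (translateTest φ z))
      = f (translateTest φ z)) ∧ ∀ η : TestFn d, tsupport η ⊆ K →
        F (testJet N (testConvolution η φ)) = f (testConvolution η φ) := by
  have hc : IsCompact ((fun p : Rn d × Rn d => p.1 + p.2) '' (K ×ˢ tsupport φ)) :=
    (hK.prod φ.hasCompactSupport).image continuous_add
  obtain ⟨N, F, hF⟩ := exists_functional_jet f hc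
  refine ⟨N, F, fun z hz => hF _ ?_, fun η hη => hF _ ?_⟩
  · refine (tsupport_translateTest_subset φ z).trans (image_mono (prod_mono ?_ subset_rfl))
    simpa using hz
  · refine closure_minimal ?_ hc.isClosed
    intro y hy
    obtain ⟨a, ha, b, hb, rfl⟩ := support_convolution_subset (ContinuousLinearMap.mul ℂ ℂ) hy
    exact ⟨(a, b), ⟨hη (subset_tsupport _ ha), subset_tsupport _ hb⟩, rfl⟩

theorem continuous_apply_translateTest (f : Distr d) (φ : TestFn d) :
    Continuous fun z => f (translateTest φ z) := by
  rw [continuous_iff_continuousAt]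
  intro z
  obtain ⟨N, F, hF, -⟩ := exists_functional_testJet_translateTest f φ (isCompact_closedBall z 1)
  have h : ContinuousAt (fun z => F (testJet N (translateTest φ z))) z :=
    (F.continuous.comp (continuous_testJet_translateTest N φ)).continuousAt
  refine h.congr ?_
  filter_upwards [Metric.closedBall_mem_nhds z one_pos] with y hy using hF y hy

theorem listDeriv_testConvolution (η φ : TestFn d) (l : List (Fin d)) :
    listDeriv l (testConvolution η φ) = η ⋆[ContinuousLinearMap.mul ℂ ℂ] listDeriv l φ :=
  listDeriv_convolution_right η.continuous.locallyIntegrable φ.contDiff φ.hasCompactSupport l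

theorem integrable_smul_testJet_translateTest (N : ℕ) (η φ : TestFn d) :
    Integrable fun z => η z • testJet N (translateTest φ z) := by
  have h : Continuous fun z => η z • testJet N (translateTest φ z) :=
    Continuous.smul η.continuous (continuous_testJet_translateTest N φ)
  have hs : HasCompactSupport fun z => η z • testJet N (translateTest φ z) :=
    η.hasCompactSupport.mono fun z hz hη => hz (by beta_reduce; rw [hη, zero_smul])
  exact h.integrable_of_hasCompactSupport hs

theorem integral_smul_testJet_translateTest (N : ℕ) (η φ : TestFn d) :
    ∫ z, η z • testJet N (translateTest φ z) = testJet N (testConvolution η φ) := by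
  have hint := integrable_smul_testJet_translateTest N η φ
  funext l
  ext1 y
  let ev : JetSpace d N →L[ℂ] ℂ :=
    (BoundedContinuousFunction.evalCLM ℂ y).comp (ContinuousLinearMap.proj l)
  have hev : ∀ v : JetSpace d N, ev v = v l y := fun _ => rfl
  rw [← hev, ← hev, ← ev.integral_comp_comm hint, hev, testJet, jet_apply,
    listDeriv_testConvolution]
  refine integral_congr_ae (Filter.Eventually.of_forall fun z => ?_)
  change η z * listDeriv l.1 (translateTest φ z) y = _
  rw [listDeriv_translateTest]
  rfl

/-- A distribution commutes with the convolution integral `η * φ = ∫ η(z) φ(· - z) dz`. -/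
theorem apply_testConvolution (f : Distr d) (η φ : TestFn d) :
    f (testConvolution η φ) = ∫ z, η z * f (translateTest φ z) := by
  obtain ⟨N, F, hF, hF'⟩ := exists_functional_testJet_translateTest f φ η.hasCompactSupport
  rw [← hF' η subset_rfl, ← integral_smul_testJet_translateTest,
    ← F.integral_comp_comm (integrable_smul_testJet_translateTest N η φ)]
  refine integral_congr_ae (Filter.Eventually.of_forall fun z => ?_)
  simp only [map_smul, smul_eq_mul]
  by_cases hz : z ∈ tsupport η
  · rw [hF z hz]
  · rw [image_eq_zero_of_notMem_tsupport hz, zero_mul, zero_mul]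

/-- The reflected test function `y ↦ φ (-y)`. -/
def reflTest (φ : TestFn d) : TestFn d := reflTranslate φ 0

@[simp] theorem reflTest_apply (φ : TestFn d) (y : Rn d) : reflTest φ y = φ (-y) := by
  simp [reflTest]

theorem translateTest_reflTest (φ : TestFn d) (x : Rn d) :
    translateTest (reflTest φ) x = reflTranslate φ x := by
  ext y
  simp

theorem continuous_distrConv (f : Distr d) (φ : TestFn d) : Continuous (distrConv f φ) := by
  have := continuous_apply_translateTest f (reflTest φ)
  simp_rw [translateTest_reflTest] at this
  exact this

/-- Associativity: `f * (χ * φ) = (f * χ) * φ`. -/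
theorem distrConv_testConvolution (f : Distr d) (χ φ : TestFn d) :
    distrConv f (testConvolution χ φ)
      = distrConv f χ ⋆[ContinuousLinearMap.mul ℂ ℂ] φ := by
  ext x
  have h : reflTranslate (testConvolution χ φ) x
      = testConvolution (reflTranslate φ x) (reflTest χ) := by
    ext y
    rw [reflTranslate_apply, testConvolution_apply, testConvolution_apply,
      ← integral_sub_right_eq_self _ y]
    refine integral_congr_ae (Filter.Eventually.of_forall fun z => ?_)
    simp only [reflTranslate_apply, reflTest_apply]
    rw [mul_comm, sub_sub_sub_cancel_right, neg_sub]
  rw [distrConv, h, apply_testConvolution]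
  simp_rw [translateTest_reflTest]
  refine integral_congr_ae (Filter.Eventually.of_forall fun z => ?_)
  simp [distrConv, mul_comm]

/-- Duality: `⟨f * φ, η⟩ = ⟨f, φ^∨ * η⟩ = ∫ φ(-z) ⟨f, η(· - z)⟩ dz`. -/
theorem integral_distrConv_mul (f : Distr d) (φ η : TestFn d) :
    ∫ x, distrConv f φ x * η x = ∫ z, φ (-z) * f (translateTest η z) := by
  have h : testConvolution η (reflTest φ) = testConvolution (reflTest φ) η := by
    ext y
    rw [testConvolution_apply, testConvolution_apply, ← integral_sub_left_eq_self _ volume y]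
    simp [mul_comm]
  have h1 := apply_testConvolution f η (reflTest φ)
  simp_rw [translateTest_reflTest] at h1
  have h2 := apply_testConvolution f (reflTest φ) η
  rw [← h, h1] at h2
  simp_rw [reflTest_apply] at h2
  rw [← h2]
  refine integral_congr_ae (Filter.Eventually.of_forall fun z => ?_)
  simp [distrConv, mul_comm]

@[simp] theorem dilate_apply (j : ℕ) (φ : TestFn d) (x : Rn d) :
    dilate j φ x = (2 : ℂ) ^ (j * d) * φ ((2 : ℝ) ^ j • x) := rfl

theorem integral_dilate_comp (j : ℕ) (φ : TestFn d) (H : Rn d → ℂ) :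
    ∫ y, H y * dilate j φ y = ∫ y, H (((2 : ℝ) ^ j)⁻¹ • y) * φ y := by
  have h := Measure.integral_comp_smul (volume : Measure (Rn d))
    (fun y => H (((2 : ℝ) ^ j)⁻¹ • y) * φ y) ((2 : ℝ) ^ j)
  have h2 : (2 : ℝ) ^ j ≠ 0 := by positivity
  simp only [smul_smul, inv_mul_cancel₀ h2, one_smul, finrank_euclideanSpace, Fintype.card_fin]
    at h
  have h3 : ∀ y, H y * dilate j φ y
      = (2 : ℂ) ^ (j * d) * (H y * φ ((2 : ℝ) ^ j • y)) := by
    intro y; rw [dilate_apply]; ring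
  simp_rw [h3]
  rw [integral_const_mul, h, abs_of_pos (by positivity), Complex.real_smul, ← mul_assoc]
  have h4 : (2 : ℂ) ^ (j * d) * (((((2 : ℝ) ^ j) ^ d)⁻¹ : ℝ) : ℂ) = 1 := by
    push_cast
    rw [← pow_mul]
    exact mul_inv_cancel₀ (pow_ne_zero _ two_ne_zero)
  rw [h4, one_mul]

/-- If `∫ φ = 1`, the regularizations `f * φ_j` converge to `f` as distributions. -/
theorem tendsto_integral_distrConv_dilate (f : Distr d) (φ η : TestFn d) (hφ : ∫ x, φ x = 1) :
    Filter.Tendsto (fun j : ℕ => ∫ x, distrConv f (dilate j φ) x * η x) Filter.atTop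
      (nhds (f η)) := by
  have hc := continuous_apply_translateTest f η
  have h1 : ∀ j : ℕ, ∫ x, distrConv f (dilate j φ) x * η x
      = ∫ y, f (translateTest η (((2 : ℝ) ^ j)⁻¹ • (-y))) * φ y := by
    intro j
    rw [integral_distrConv_mul, ← integral_neg_eq_self]
    have := integral_dilate_comp j φ (fun y => f (translateTest η (-y)))
    simp only [neg_neg, smul_neg]
    rw [← this]
    refine integral_congr_ae (Filter.Eventually.of_forall fun z => ?_)
    simp only [mul_comm]
  simp_rw [h1]
  obtain ⟨R, hR⟩ := φ.hasCompactSupport.isBounded.subset_closedBall (0 : Rn d)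
  obtain ⟨A, hA⟩ := (isCompact_closedBall (0 : Rn d) R).exists_bound_of_continuousOn
    hc.continuousOn
  have h0 : f η = ∫ y, f η * φ y := by rw [integral_const_mul, hφ, mul_one]
  rw [h0]
  refine tendsto_integral_of_dominated_convergence (fun y => A * ‖φ y‖) ?_ ?_ ?_ ?_
  · intro j
    have h2 : Continuous fun y => f (translateTest η (((2 : ℝ) ^ j)⁻¹ • (-y))) :=
      hc.comp (continuous_id.neg.const_smul (((2 : ℝ) ^ j)⁻¹))
    exact (Continuous.mul h2 φ.continuous).aestronglyMeasurable
  · exact (φ.continuous.norm.integrable_of_hasCompactSupport φ.hasCompactSupport.norm).const_mul _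
  · intro j
    refine Filter.Eventually.of_forall fun y => ?_
    rw [norm_mul]
    by_cases hy : y ∈ tsupport φ
    · gcongr
      refine hA _ ?_
      have hyR := hR hy
      rw [mem_closedBall_zero_iff] at hyR ⊢
      rw [norm_smul, norm_neg, norm_inv, norm_pow, Real.norm_two]
      refine le_trans (mul_le_of_le_one_left (norm_nonneg _) ?_) hyR
      exact inv_le_one_of_one_le₀ (one_le_pow₀ one_le_two)
    · simp [image_eq_zero_of_notMem_tsupport hy]
  · refine Filter.Eventually.of_forall fun y => ?_
    refine Filter.Tendsto.mul_const _ ?_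
    have h2 : Filter.Tendsto (fun j : ℕ => ((2 : ℝ) ^ j)⁻¹ • (-y)) Filter.atTop (nhds 0) := by
      have : Filter.Tendsto (fun j : ℕ => ((2 : ℝ) ^ j)⁻¹) Filter.atTop (nhds 0) :=
        tendsto_inv_atTop_zero.comp (tendsto_pow_atTop_atTop_of_one_lt one_lt_two)
      simpa using this.smul_const (-y)
    have h3 : translateTest η 0 = η := by ext; simp
    have := (hc.tendsto 0).comp h2
    rwa [h3] at this

end Distributions

/-! ### Solid translation-invariant Banach function spaces -/

section TIBF

variable {d : ℕ} {B : Type*} [NormedAddCommGroup B] [NormedSpace ℂ B]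

namespace SolidTIBF

variable {E : SolidTIBF d B}

/-- The function `g` belongs to `E`, with norm at most `c`. -/
def MemLE (E : SolidTIBF d B) (g : Rn d → ℂ) (c : ℝ) : Prop :=
  ∃ e : B, E.incl e =ᵐ[volume] g ∧ ‖e‖ ≤ c

theorem MemLE.mono {g : Rn d → ℂ} {c c' : ℝ} (h : E.MemLE g c) (hc : c ≤ c') : E.MemLE g c' :=
  let ⟨e, he, hec⟩ := h
  ⟨e, he, hec.trans hc⟩

theorem MemLE.nonneg {g : Rn d → ℂ} {c : ℝ} (h : E.MemLE g c) : 0 ≤ c :=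
  let ⟨_, _, hec⟩ := h
  (norm_nonneg _).trans hec

theorem MemLE.aestronglyMeasurable {g : Rn d → ℂ} {c : ℝ} (h : E.MemLE g c) :
    AEStronglyMeasurable g volume :=
  let ⟨e, he, _⟩ := h
  (E.incl e).aestronglyMeasurable.congr he

theorem MemLE.locallyIntegrable {g : Rn d → ℂ} {c : ℝ} (h : E.MemLE g c) :
    LocallyIntegrable g volume :=
  let ⟨e, he, _⟩ := h
  (E.locallyIntegrable e).congr he

theorem MemLE.add {g g' : Rn d → ℂ} {c c' : ℝ} (h : E.MemLE g c) (h' : E.MemLE g' c') :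
    E.MemLE (g + g') (c + c') := by
  obtain ⟨e, he, hec⟩ := h
  obtain ⟨e', he', hec'⟩ := h'
  refine ⟨e + e', ?_, (norm_add_le _ _).trans (add_le_add hec hec')⟩
  rw [map_add]
  exact (AEEqFun.coeFn_add _ _).trans (he.add he')

theorem MemLE.smul {g : Rn d → ℂ} {c : ℝ} (h : E.MemLE g c) (a : ℂ) :
    E.MemLE (a • g) (‖a‖ * c) := by
  obtain ⟨e, he, hec⟩ := h
  refine ⟨a • e, ?_, ?_⟩
  · rw [map_smul]
    exact (AEEqFun.coeFn_smul _ _).trans (he.const_smul a)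
  · rw [norm_smul]
    gcongr

theorem memLE_zero : E.MemLE 0 0 :=
  ⟨0, by rw [map_zero]; exact AEEqFun.coeFn_zero, by simp⟩

theorem memLE_sum {ι : Type*} (s : Finset ι) {g : ι → Rn d → ℂ} {c : ι → ℝ}
    (h : ∀ i ∈ s, E.MemLE (g i) (c i)) : E.MemLE (∑ i ∈ s, g i) (∑ i ∈ s, c i) := by
  classical
  induction s using Finset.induction_on with
  | empty => simpa using memLE_zero
  | insert a s ha ih =>
    rw [Finset.sum_insert ha, Finset.sum_insert ha]
    exact (h a (Finset.mem_insert_self _ _)).add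
      (ih fun i hi => h i (Finset.mem_insert_of_mem hi))

/-- Solidity. -/
theorem MemLE.of_norm_le {g h : Rn d → ℂ} {c : ℝ} (hh : E.MemLE h c)
    (hg : AEStronglyMeasurable g volume) (hgh : ∀ᵐ x, ‖g x‖ ≤ ‖h x‖) : E.MemLE g c := by
  have hl : LocallyIntegrable g volume := hh.locallyIntegrable.mono hg hgh
  obtain ⟨e, he, hec⟩ := hh
  obtain ⟨e', he', hec'⟩ := E.solid e g hl (by
    filter_upwards [he, hgh] with x h1 h2
    rwa [h1])
  exact ⟨e', he', hec'.trans hec⟩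

theorem MemLE.norm {g : Rn d → ℂ} {c : ℝ} (h : E.MemLE g c) :
    E.MemLE (fun x => ((‖g x‖ : ℝ) : ℂ)) c :=
  h.of_norm_le (Complex.continuous_ofReal.comp_aestronglyMeasurable h.aestronglyMeasurable.norm)
    (Filter.Eventually.of_forall fun x => by simp)

theorem exists_setIntegral_le (E : SolidTIBF d B) {K : Set (Rn d)} (hK : IsCompact K) :
    ∃ C : ℝ, 0 ≤ C ∧ ∀ f : B, ∫ x in K, ‖E.incl f x‖ ≤ C * ‖f‖ := by
  obtain ⟨C, hC⟩ := E.continuous_incl K hK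
  refine ⟨max C 0, le_max_right _ _, fun f => (hC f).trans ?_⟩
  gcongr
  exact le_max_left _ _

theorem exists_lintegral_le (E : SolidTIBF d B) {K : Set (Rn d)} (hK : IsCompact K) :
    ∃ C : ℝ, 0 ≤ C ∧ ∀ f : B, ∫⁻ x in K, ‖E.incl f x‖ₑ ≤ ENNReal.ofReal (C * ‖f‖) := by
  obtain ⟨C, hC0, hC⟩ := E.exists_setIntegral_le hK
  refine ⟨C, hC0, fun f => ?_⟩
  rw [← ofReal_integral_norm_eq_lintegral_enorm
    ((E.locallyIntegrable f).integrableOn_isCompact hK)]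
  exact ENNReal.ofReal_le_ofReal (hC f)

/-- Norm limits in `E` agree with almost everywhere limits. -/
theorem incl_eq_of_tendsto {u : ℕ → B} {y : B} {g : Rn d → ℂ}
    (hu : Filter.Tendsto u Filter.atTop (nhds y))
    (hg : ∀ᵐ x, Filter.Tendsto (fun n => E.incl (u n) x) Filter.atTop (nhds (g x))) :
    E.incl y =ᵐ[volume] g := by
  have hsub : ∀ n, E.incl (y - u n) =ᵐ[volume] fun x => E.incl y x - E.incl (u n) x := by
    intro n
    rw [map_sub]
    exact AEEqFun.coeFn_sub _ _
  have hball : ∀ k : ℕ, ∀ᵐ x ∂volume.restrict (Metric.closedBall (0 : Rn d) k),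
      E.incl y x = g x := by
    intro k
    obtain ⟨C, hC0, hC⟩ := E.exists_lintegral_le (isCompact_closedBall (0 : Rn d) k)
    let F : ℕ → Rn d → ENNReal := fun n x => ‖E.incl (y - u n) x‖ₑ
    have hF : ∀ n, AEMeasurable (F n) (volume.restrict (Metric.closedBall (0 : Rn d) k)) :=
      fun n => (E.incl (y - u n)).aestronglyMeasurable.restrict.enorm
    have hlim : Filter.Tendsto (fun n => ENNReal.ofReal (C * ‖y - u n‖)) Filter.atTop
        (nhds 0) := by
      have h1 : Filter.Tendsto (fun n => C * ‖y - u n‖) Filter.atTop (nhds (C * ‖y - y‖)) :=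
        ((tendsto_const_nhds.sub hu).norm).const_mul C
      have := ENNReal.tendsto_ofReal h1
      simpa using this
    have hae : ∀ᵐ x ∂volume.restrict (Metric.closedBall (0 : Rn d) k),
        Filter.Tendsto (fun n => F n x) Filter.atTop (nhds ‖E.incl y x - g x‖ₑ) := by
      filter_upwards [ae_restrict_of_ae hg, ae_restrict_of_ae (ae_all_iff.2 hsub)] with x h2 h3
      simp only [F, h3]
      exact (tendsto_const_nhds.sub h2).enorm
    have hfatou : ∫⁻ x in Metric.closedBall (0 : Rn d) k, ‖E.incl y x - g x‖ₑ = 0 := by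
      rw [← lintegral_congr_ae (hae.mono fun x hx => hx.liminf_eq)]
      refine le_antisymm ((lintegral_liminf_le' hF).trans ?_) bot_le
      refine (Filter.liminf_le_liminf (Filter.Eventually.of_forall fun n => hC (y - u n))).trans ?_
      rw [hlim.liminf_eq]
    rw [lintegral_eq_zero_iff' (aemeasurable_of_tendsto_metrizable_ae' hF hae)] at hfatou
    filter_upwards [hfatou] with x h1
    simpa [sub_eq_zero] using h1
  have huniv : (⋃ k : ℕ, Metric.closedBall (0 : Rn d) k) = univ := Metric.iUnion_closedBall_nat 0
  have := (ae_restrict_iUnion_iff (μ := volume)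
    (fun k : ℕ => Metric.closedBall (0 : Rn d) k) (fun x => E.incl y x = g x)).2 hball
  rwa [huniv, Measure.restrict_univ] at this

theorem norm_convolution_le {g θ : Rn d → ℂ} {A : ℝ} (hg : LocallyIntegrable g)
    (hc : HasCompactSupport θ) (hA : ∀ y, ‖θ y‖ ≤ A) (x : Rn d) :
    ‖(g ⋆[ContinuousLinearMap.mul ℂ ℂ] θ) x‖
      ≤ A * ∫ t in (fun t => x - t) '' tsupport θ, ‖g t‖ := by
  have hK : IsCompact ((fun t => x - t) '' tsupport θ) :=
    hc.isCompact.image (continuous_const.sub continuous_id)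
  have hzero : ∀ t, t ∉ (fun t => x - t) '' tsupport θ →
      (ContinuousLinearMap.mul ℂ ℂ (g t)) (θ (x - t)) = 0 := by
    intro t ht
    have : x - t ∉ tsupport θ := fun h => ht ⟨x - t, h, by simp⟩
    simp [image_eq_zero_of_notMem_tsupport this]
  rw [convolution, ← setIntegral_eq_integral_of_forall_compl_eq_zero hzero, ← integral_const_mul]
  refine norm_integral_le_of_norm_le ((hg.integrableOn_isCompact hK).norm.const_mul A)
    (Filter.Eventually.of_forall fun t => ?_)
  rw [ContinuousLinearMap.mul_apply', norm_mul, mul_comm]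
  gcongr
  exact hA _

/-- By the closed graph theorem, convolution with a compactly supported continuous function is a
bounded operator on `E`. -/
theorem exists_convolution_bound [CompleteSpace B] (E : SolidTIBF d B) {θ : Rn d → ℂ}
    (hθ : Continuous θ) (hc : HasCompactSupport θ) :
    ∃ C : ℝ, 0 ≤ C ∧ ∀ (g : Rn d → ℂ) (c : ℝ), E.MemLE g c →
      E.MemLE (g ⋆[ContinuousLinearMap.mul ℂ ℂ] θ) (C * c) := by
  have hex : ∀ e : B, ConvolutionExists (E.incl e) θ (ContinuousLinearMap.mul ℂ ℂ) volume :=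
    fun e => hc.convolutionExists_right (ContinuousLinearMap.mul ℂ ℂ) (E.locallyIntegrable e) hθ
  choose T₀ hspec using fun e : B => E.conv e θ hθ hc
  let T : B →ₗ[ℂ] B :=
    { toFun := T₀
      map_add' := fun e e' => by
        apply E.incl_injective
        rw [map_add]
        refine AEEqFun.ext ?_
        have h1 : E.incl (e + e') ⋆[ContinuousLinearMap.mul ℂ ℂ] θ
            = (E.incl e + E.incl e' : Rn d → ℂ) ⋆[ContinuousLinearMap.mul ℂ ℂ] θ := by
          refine convolution_congr _ ?_ (ae_eq_refl _)
          rw [map_add]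
          exact AEEqFun.coeFn_add _ _
        filter_upwards [hspec (e + e'), hspec e, hspec e', AEEqFun.coeFn_add
          (E.incl (T₀ e)) (E.incl (T₀ e'))]
          with x h2 h3 h4 h5
        rw [h2, h5, Pi.add_apply, h3, h4, h1, (hex e).add_distrib (hex e')]
        rfl
      map_smul' := fun a e => by
        apply E.incl_injective
        rw [map_smul, RingHom.id_apply]
        refine AEEqFun.ext ?_
        have h1 : E.incl (a • e) ⋆[ContinuousLinearMap.mul ℂ ℂ] θ
            = (a • (E.incl e : Rn d → ℂ)) ⋆[ContinuousLinearMap.mul ℂ ℂ] θ := by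
          refine convolution_congr _ ?_ (ae_eq_refl _)
          rw [map_smul]
          exact AEEqFun.coeFn_smul _ _
        filter_upwards [hspec (a • e), hspec e, AEEqFun.coeFn_smul a
          (E.incl (T₀ e))] with x h2 h3 h4
        rw [h2, h4, Pi.smul_apply, h3, h1, smul_convolution]
        rfl }
  obtain ⟨A, hA⟩ := hθ.bounded_above_of_compact_support hc
  have hT : Continuous T := by
    refine T.continuous_of_seq_closed_graph fun u x y hu hTu => ?_
    apply E.incl_injective
    refine AEEqFun.ext ((E.incl_eq_of_tendsto hTu ?_).trans (hspec x).symm)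
    filter_upwards [ae_all_iff.2 fun n => hspec (u n)] with t ht
    have hK : IsCompact ((fun s => t - s) '' tsupport θ) :=
      hc.isCompact.image (continuous_const.sub continuous_id)
    obtain ⟨C, hC0, hC⟩ := E.exists_setIntegral_le hK
    rw [tendsto_iff_norm_sub_tendsto_zero]
    have hb : Filter.Tendsto (fun n => A * (C * ‖u n - x‖)) Filter.atTop (nhds 0) := by
      have : Filter.Tendsto (fun n => A * (C * ‖u n - x‖)) Filter.atTop
          (nhds (A * (C * ‖x - x‖))) :=
        (((hu.sub tendsto_const_nhds).norm).const_mul C).const_mul A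
      simpa using this
    refine squeeze_zero (fun n => norm_nonneg _) (fun n => ?_) hb
    have h1 : E.incl (T (u n)) t - (E.incl x ⋆[ContinuousLinearMap.mul ℂ ℂ] θ) t
        = (E.incl (u n - x) ⋆[ContinuousLinearMap.mul ℂ ℂ] θ) t := by
      have h2 : E.incl (u n - x) ⋆[ContinuousLinearMap.mul ℂ ℂ] θ
          = (E.incl (u n) + (-1 : ℂ) • E.incl x : Rn d → ℂ)
            ⋆[ContinuousLinearMap.mul ℂ ℂ] θ := by
        refine convolution_congr _ ?_ (ae_eq_refl _)
        rw [map_sub]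
        filter_upwards [AEEqFun.coeFn_sub (E.incl (u n)) (E.incl x)] with s hs
        rw [hs]
        simp [sub_eq_add_neg]
      have h3 : ConvolutionExists ((-1 : ℂ) • E.incl x : Rn d → ℂ) θ
          (ContinuousLinearMap.mul ℂ ℂ) volume :=
        hc.convolutionExists_right (ContinuousLinearMap.mul ℂ ℂ)
          ((E.locallyIntegrable x).smul _) hθ
      have h4 : E.incl (T (u n)) t = (E.incl (u n) ⋆[ContinuousLinearMap.mul ℂ ℂ] θ) t := ht n
      rw [h2, (hex (u n)).add_distrib h3, smul_convolution, h4]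
      simp [sub_eq_add_neg]
    rw [Function.comp_apply, h1]
    refine (norm_convolution_le (E.locallyIntegrable _) hc hA t).trans ?_
    have hA0 : 0 ≤ A := (norm_nonneg _).trans (hA 0)
    gcongr
    exact hC _
  let T' : B →L[ℂ] B := ⟨T, hT⟩
  refine ⟨‖T'‖, norm_nonneg _, fun g c ⟨e, he, hec⟩ => ⟨T' e, ?_, ?_⟩⟩
  · refine (hspec e).trans (Filter.EventuallyEq.of_eq ?_)
    exact convolution_congr _ he (ae_eq_refl _)
  · exact (T'.le_opNorm e).trans (by gcongr)

/-- The local averages of `‖g‖` are dominated by an element of `E`, namely by a convolution. -/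
theorem exists_setIntegral_closedBall_le [CompleteSpace B] (E : SolidTIBF d B) {ρ : ℝ}
    (hρ : 0 < ρ) :
    ∃ C : ℝ, 0 ≤ C ∧ ∀ (g : Rn d → ℂ) (c : ℝ), E.MemLE g c → ∃ h : Rn d → ℂ,
      E.MemLE h (C * c) ∧ ∀ x, ∫ y in Metric.closedBall x ρ, ‖g y‖ ≤ ‖h x‖ := by
  let θ : ContDiffBump (0 : Rn d) := ⟨ρ, ρ + 1, hρ, by linarith⟩
  have hθc : Continuous θ := θ.continuous
  obtain ⟨C, hC0, hC⟩ := E.exists_convolution_bound (θ := fun x => ((θ x : ℝ) : ℂ))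
    (Complex.continuous_ofReal.comp hθc) (θ.hasCompactSupport.comp_left Complex.ofReal_zero)
  refine ⟨C, hC0, fun g c hg => ⟨_, hC _ c hg.norm, fun x => ?_⟩⟩
  have hint : Integrable (fun t => ‖g t‖ * θ (x - t)) :=
    θ.hasCompactSupport.convolutionExists_right (ContinuousLinearMap.mul ℝ ℝ)
      (hg.locallyIntegrable.mono hg.aestronglyMeasurable.norm (by simp)) hθc x
  have h1 : ((fun x => ((‖g x‖ : ℝ) : ℂ)) ⋆[ContinuousLinearMap.mul ℂ ℂ]
      fun x => ((θ x : ℝ) : ℂ)) x = ((∫ t, ‖g t‖ * θ (x - t) : ℝ) : ℂ) := by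
    rw [convolution, ← integral_complex_ofReal]
    refine integral_congr_ae (Filter.Eventually.of_forall fun t => ?_)
    simp
  rw [h1, Complex.norm_real]
  refine le_trans ?_ (le_abs_self _)
  rw [← integral_indicator Metric.isClosed_closedBall.measurableSet]
  refine integral_mono_of_nonneg
    (Filter.Eventually.of_forall fun t => indicator_nonneg (fun _ _ => norm_nonneg _) t) hint
    (Filter.Eventually.of_forall fun t => ?_)
  by_cases ht : t ∈ Metric.closedBall x ρ
  · beta_reduce
    rw [indicator_of_mem ht, θ.one_of_mem_closedBall, mul_one]
    rw [mem_closedBall_zero_iff]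
    rwa [mem_closedBall_iff_norm'] at ht
  · rw [indicator_of_notMem ht]
    exact mul_nonneg (norm_nonneg _) θ.nonneg

/-- As translations are uniformly bounded, `E` embeds into the uniformly locally integrable
functions. -/
theorem exists_setIntegral_closedBall_le_norm (E : SolidTIBF d B) :
    ∃ C : ℝ, 0 ≤ C ∧ ∀ (g : Rn d → ℂ) (c : ℝ), E.MemLE g c →
      ∀ x, ∫ y in Metric.closedBall x 1, ‖g y‖ ≤ C * c := by
  obtain ⟨C₀, hC₀, htr⟩ := E.translate_bound
  obtain ⟨C, hC0, hC⟩ := E.exists_setIntegral_le (isCompact_closedBall (0 : Rn d) 1)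
  refine ⟨C * C₀, by positivity, fun g c ⟨e, he, hec⟩ x => ?_⟩
  obtain ⟨e', he'⟩ := E.translate (-x) e
  have hpre : (fun t : Rn d => t + x) ⁻¹' Metric.closedBall x 1 = Metric.closedBall 0 1 := by
    ext t
    simp
  calc ∫ y in Metric.closedBall x 1, ‖g y‖
      = ∫ y in Metric.closedBall x 1, ‖E.incl e y‖ := by
        refine setIntegral_congr_ae Metric.isClosed_closedBall.measurableSet ?_
        filter_upwards [he] with y hy _
        rw [hy]
    _ = ∫ t in Metric.closedBall 0 1, ‖E.incl e (t + x)‖ := by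
        rw [← hpre]
        exact ((measurePreserving_add_right volume x).setIntegral_preimage_emb
          (measurableEmbedding_addRight x) _ _).symm
    _ = ∫ t in Metric.closedBall 0 1, ‖E.incl e' t‖ := by
        refine setIntegral_congr_ae Metric.isClosed_closedBall.measurableSet ?_
        filter_upwards [he'] with y hy _
        rw [hy, sub_neg_eq_add]
    _ ≤ C * ‖e'‖ := hC e'
    _ ≤ C * (C₀ * c) := by
        gcongr
        exact (htr (-x) e e' he').trans (by gcongr)
    _ = C * C₀ * c := by ring

end SolidTIBF

end TIBF

/-! ### Quantitative membership in the weighted spaces -/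

section Weighted

variable {d : ℕ} {B : Type*} [NormedAddCommGroup B] [NormedSpace ℂ B]
variable {E : SolidTIBF d B} {w : ℕ → Rn d → ℝ}

/-- All derivatives of `u` of order at most `n`, multiplied by `w n`, belong to `E` with norm at
most `M`. -/
def GSBound (E : SolidTIBF d B) (w : ℕ → Rn d → ℝ) (n : ℕ) (M : ℝ) (u : Rn d → ℂ) : Prop :=
  ∀ l : List (Fin d), l.length ≤ n → E.MemLE (fun x => listDeriv l u x * (w n x : ℂ)) M

theorem IsWeightSystem.mono' (hw : IsWeightSystem w) {m n : ℕ} (h : m ≤ n) (x : Rn d) :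
    w m x ≤ w n x :=
  monotone_nat_of_le_succ (f := fun n => w n x) (fun n => hw.mono n x) h

theorem IsWeightSystem.pos (hw : IsWeightSystem w) (n : ℕ) (x : Rn d) : 0 < w n x :=
  one_pos.trans_le (hw.one_le n x)

theorem aestronglyMeasurable_mul_weight (hw : IsWeightSystem w) {u : Rn d → ℂ}
    (hu : Continuous u) (n : ℕ) :
    AEStronglyMeasurable (fun x => u x * (w n x : ℂ)) volume :=
  hu.aestronglyMeasurable.mul
    (Complex.continuous_ofReal.comp_aestronglyMeasurable
      (hw.aemeasurable n).aestronglyMeasurable)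

theorem norm_mul_weight (hw : IsWeightSystem w) (n : ℕ) (x : Rn d) (z : ℂ) :
    ‖z * (w n x : ℂ)‖ = ‖z‖ * w n x := by
  rw [norm_mul, Complex.norm_real, Real.norm_of_nonneg (hw.pos n x).le]

theorem GSBound.nonneg {n : ℕ} {M : ℝ} {u : Rn d → ℂ} (h : GSBound E w n M u) : 0 ≤ M :=
  (h [] (by simp)).nonneg

theorem GSBound.mono {n : ℕ} {M M' : ℝ} {u : Rn d → ℂ} (h : GSBound E w n M u) (hM : M ≤ M') :
    GSBound E w n M' u := fun l hl => (h l hl).mono hM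

theorem GSBound.listDeriv (hw : IsWeightSystem w) {n k : ℕ} {M : ℝ} {u : Rn d → ℂ}
    (hu : ContDiff ℝ ∞ u) (h : GSBound E w (n + k) M u) {l : List (Fin d)} (hl : l.length ≤ k) :
    GSBound E w n M (listDeriv l u) := by
  intro l' hl'
  refine (h (l' ++ l) (by simp; omega)).of_norm_le
    (aestronglyMeasurable_mul_weight hw
      (contDiff_listDeriv (contDiff_listDeriv hu l) l').continuous n)
    (Filter.Eventually.of_forall fun x => ?_)
  rw [norm_mul_weight hw, norm_mul_weight hw, listDeriv_append]
  gcongr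
  exact hw.mono' (by omega) x

theorem GSBound.add {n : ℕ} {M M' : ℝ} {u v : Rn d → ℂ} (hu : ContDiff ℝ ∞ u)
    (hv : ContDiff ℝ ∞ v) (h : GSBound E w n M u) (h' : GSBound E w n M' v) :
    GSBound E w n (M + M') (u + v) := by
  intro l hl
  convert (h l hl).add (h' l hl) using 1
  ext x
  rw [listDeriv_add hu hv, Pi.add_apply, Pi.add_apply, add_mul]

theorem GSBound.smul {n : ℕ} {M : ℝ} {u : Rn d → ℂ} (hu : ContDiff ℝ ∞ u)
    (h : GSBound E w n M u) (a : ℂ) : GSBound E w n (‖a‖ * M) (a • u) := by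
  intro l hl
  convert (h l hl).smul a using 1
  ext x
  rw [listDeriv_smul a hu, Pi.smul_apply, Pi.smul_apply, smul_mul_assoc]

theorem gsBound_zero (n : ℕ) : GSBound E w n 0 (0 : Rn d → ℂ) := by
  intro l _
  convert SolidTIBF.memLE_zero using 1
  ext x
  have := listDeriv_smul (d := d) 0 (u := 0) contDiff_zero_fun l
  rw [zero_smul, zero_smul] at this
  rw [this]
  simp

theorem gsBound_sum {ι : Type*} (s : Finset ι) {n : ℕ} {g : ι → Rn d → ℂ} {M : ι → ℝ}
    (hg : ∀ i ∈ s, ContDiff ℝ ∞ (g i)) (h : ∀ i ∈ s, GSBound E w n (M i) (g i)) :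
    GSBound E w n (∑ i ∈ s, M i) (∑ i ∈ s, g i) := by
  classical
  induction s using Finset.induction_on with
  | empty => simpa using gsBound_zero n
  | insert a s ha ih =>
    rw [Finset.sum_insert ha, Finset.sum_insert ha]
    refine GSBound.add (hg a (Finset.mem_insert_self _ _)) ?_ (h a (Finset.mem_insert_self _ _))
      (ih (fun i hi => hg i (Finset.mem_insert_of_mem hi))
        (fun i hi => h i (Finset.mem_insert_of_mem hi)))
    have : ContDiff ℝ ∞ (fun x => ∑ i ∈ s, g i x) :=
      ContDiff.sum fun i hi => hg i (Finset.mem_insert_of_mem hi)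
    convert this using 1
    ext x
    simp

/-- Iteration of (wM): translations by vectors of a fixed ball. -/
theorem WeakModerate.exists_le (hwM : WeakModerate w) (n : ℕ) (R : ℝ) :
    ∃ (m : ℕ) (C : ℝ), 0 < C ∧ ∀ x y : Rn d, ‖y‖ ≤ R → w n (x + y) ≤ C * w m x := by
  have key : ∀ k n : ℕ, ∃ (m : ℕ) (C : ℝ), 0 < C ∧ ∀ x y : Rn d, ‖y‖ ≤ k →
      w n (x + y) ≤ C * w m x := by
    intro k
    induction k with
    | zero =>
      refine fun n => ⟨n, 1, one_pos, fun x y hy => ?_⟩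
      have : y = 0 := by simpa using hy
      simp [this]
    | succ k ih =>
      intro n
      obtain ⟨m, -, C, hC, h⟩ := hwM n
      obtain ⟨m', C', hC', h'⟩ := ih m
      refine ⟨m', C * C', by positivity, fun x y hy => ?_⟩
      have hk : (0 : ℝ) < (k : ℝ) + 1 := by positivity
      push_cast at hy
      have h1 : ‖((k : ℝ) + 1)⁻¹ • y‖ ≤ 1 := by
        rw [norm_smul, norm_inv, Real.norm_of_nonneg hk.le, inv_mul_le_iff₀ hk]
        simpa using hy
      have h2 : ‖((k : ℝ) / ((k : ℝ) + 1)) • y‖ ≤ k := by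
        rw [norm_smul, Real.norm_of_nonneg (by positivity), div_mul_eq_mul_div, div_le_iff₀ hk]
        gcongr
      have h3 : x + y = (x + ((k : ℝ) / ((k : ℝ) + 1)) • y) + ((k : ℝ) + 1)⁻¹ • y := by
        rw [add_assoc, ← add_smul]
        congr 1
        rw [show (k : ℝ) / ((k : ℝ) + 1) + ((k : ℝ) + 1)⁻¹ = 1 by field_simp, one_smul]
      calc w n (x + y) ≤ C * w m (x + ((k : ℝ) / ((k : ℝ) + 1)) • y) := by
            rw [h3]
            exact h _ _ (mem_closedBall_zero_iff.2 h1)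
        _ ≤ C * (C' * w m' x) := by
            gcongr
            exact h' _ _ h2
        _ = C * C' * w m' x := by ring
  obtain ⟨k, hk⟩ := exists_nat_ge R
  obtain ⟨m, C, hC, h⟩ := key k n
  exact ⟨m, C, hC, fun x y hy => h x y (hy.trans hk)⟩

/-- Local suprema of `u`, multiplied by `w n`, are dominated by an element of `E`: by the Sobolev
inequality they are bounded by local averages of derivatives. -/
theorem exists_dominating_of_gsBound [CompleteSpace B] (E : SolidTIBF d B)
    (hw : IsWeightSystem w) (hwM : WeakModerate w) (n : ℕ) {R : ℝ} (hR : 0 ≤ R) :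
    ∃ (m : ℕ) (C : ℝ), 0 ≤ C ∧ ∀ (u : Rn d → ℂ) (M : ℝ), ContDiff ℝ ∞ u → GSBound E w m M u →
      ∃ h : Rn d → ℂ, E.MemLE h (C * M) ∧
        ∀ x t : Rn d, ‖t‖ ≤ R → ‖u (x - t)‖ * w n x ≤ ‖h x‖ := by
  obtain ⟨Cs, hCs, hsob⟩ := exists_norm_le_sum_setIntegral_listDeriv d
  obtain ⟨m1, C1, hC1, hm1⟩ := hwM.exists_le n (R + 1)
  obtain ⟨C2, hC2, hE⟩ := E.exists_setIntegral_closedBall_le (ρ := R + 1) (by linarith)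
  refine ⟨max m1 (d + 1), Cs * C1 * ((wordsUpTo d (d + 1)).card * C2), by positivity,
    fun u M hu hM => ?_⟩
  set m := max m1 (d + 1)
  have hg : ∀ l ∈ wordsUpTo d (d + 1), E.MemLE (fun x => listDeriv l u x * (w m x : ℂ)) M :=
    fun l hl => hM l ((length_le_of_mem_wordsUpTo hl).trans (le_max_right _ _))
  choose! h hh hh' using fun l (hl : l ∈ wordsUpTo d (d + 1)) => hE _ _ (hg l hl)
  refine ⟨((Cs * C1 : ℝ) : ℂ) • ∑ l ∈ wordsUpTo d (d + 1), fun x => ((‖h l x‖ : ℝ) : ℂ), ?_, ?_⟩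
  · refine ((SolidTIBF.memLE_sum _ fun l hl => (hh l hl).norm).smul _).mono (le_of_eq ?_)
    rw [Complex.norm_real, Real.norm_of_nonneg (by positivity), Finset.sum_const, nsmul_eq_mul]
    ring
  · intro x t ht
    have hnorm : ‖(((Cs * C1 : ℝ) : ℂ) • ∑ l ∈ wordsUpTo d (d + 1),
        fun x => ((‖h l x‖ : ℝ) : ℂ)) x‖
        = Cs * C1 * ∑ l ∈ wordsUpTo d (d + 1), ‖h l x‖ := by
      rw [Pi.smul_apply, Finset.sum_apply, ← Complex.ofReal_sum, norm_smul, Complex.norm_real,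
        Complex.norm_real, Real.norm_of_nonneg (by positivity),
        Real.norm_of_nonneg (Finset.sum_nonneg fun _ _ => norm_nonneg _)]
    rw [hnorm]
    have hsub : Metric.closedBall (x - t) 1 ⊆ Metric.closedBall x (R + 1) := by
      refine Metric.closedBall_subset_closedBall' ?_
      rw [dist_eq_norm]
      simp only [sub_sub_cancel_left, norm_neg]
      linarith
    calc ‖u (x - t)‖ * w n x
        ≤ (Cs * ∑ l ∈ wordsUpTo d (d + 1),
          ∫ y in Metric.closedBall (x - t) 1, ‖listDeriv l u y‖) * w n x := by
          gcongr
          · exact (hw.pos n x).le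
          · exact hsob u hu (x - t)
      _ = Cs * ∑ l ∈ wordsUpTo d (d + 1),
          ∫ y in Metric.closedBall (x - t) 1, ‖listDeriv l u y‖ * w n x := by
          rw [mul_assoc, Finset.sum_mul]
          simp_rw [integral_mul_const]
      _ ≤ Cs * ∑ l ∈ wordsUpTo d (d + 1), C1 * ‖h l x‖ := by
          gcongr with l hl
          have hint : IntegrableOn (fun y => ‖listDeriv l u y * (w m y : ℂ)‖)
              (Metric.closedBall x (R + 1)) :=
            ((hg l hl).locallyIntegrable.integrableOn_isCompact (isCompact_closedBall _ _)).norm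
          calc ∫ y in Metric.closedBall (x - t) 1, ‖listDeriv l u y‖ * w n x
              ≤ ∫ y in Metric.closedBall (x - t) 1,
                  C1 * ‖listDeriv l u y * (w m y : ℂ)‖ := by
                refine setIntegral_mono_on ?_ ((hint.mono_set hsub).const_mul C1)
                  Metric.isClosed_closedBall.measurableSet fun y hy => ?_
                · exact ((contDiff_listDeriv hu l).continuous.norm.mul
                    continuous_const).continuousOn.integrableOn_compact (isCompact_closedBall _ _)
                · rw [norm_mul_weight hw, mul_left_comm]
                  gcongr
                  have hy' := hsub hy
                  rw [mem_closedBall_iff_norm'] at hy'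
                  have := hm1 y (x - y) hy'
                  rw [add_sub_cancel] at this
                  refine this.trans ?_
                  gcongr
                  exact hw.mono' (le_max_left _ _) y
            _ = C1 * ∫ y in Metric.closedBall (x - t) 1, ‖listDeriv l u y * (w m y : ℂ)‖ := by
                rw [integral_const_mul]
            _ ≤ C1 * ∫ y in Metric.closedBall x (R + 1), ‖listDeriv l u y * (w m y : ℂ)‖ := by
                gcongr
                exact Filter.Eventually.of_forall fun _ => norm_nonneg _
            _ ≤ C1 * ‖h l x‖ := by
                gcongr
                exact hh' l hl x
      _ = _ := by rw [← Finset.mul_sum, mul_assoc]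

theorem exists_dominating_iteratedFDeriv_of_gsBound [CompleteSpace B] (E : SolidTIBF d B)
    (hw : IsWeightSystem w) (hwM : WeakModerate w) (n k : ℕ) {R : ℝ} (hR : 0 ≤ R) :
    ∃ (m : ℕ) (C : ℝ), 0 ≤ C ∧ ∀ (u : Rn d → ℂ) (M : ℝ), ContDiff ℝ ∞ u → GSBound E w m M u →
      ∃ h : Rn d → ℂ, E.MemLE h (C * M) ∧
        ∀ x t : Rn d, ‖t‖ ≤ R → ‖iteratedFDeriv ℝ k u (x - t)‖ * w n x ≤ ‖h x‖ := by
  obtain ⟨m, C, hC, hdom⟩ := exists_dominating_of_gsBound E hw hwM n hR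
  refine ⟨m + k, (wordsUpTo d k).card * C, by positivity, fun u M hu hM => ?_⟩
  choose! h hh hh' using fun l (hl : l ∈ wordsUpTo d k) => hdom (listDeriv l u) M
    (contDiff_listDeriv hu l) (hM.listDeriv hw hu (length_le_of_mem_wordsUpTo hl))
  refine ⟨∑ l ∈ wordsUpTo d k, fun x => ((‖h l x‖ : ℝ) : ℂ), ?_, fun x t ht => ?_⟩
  · refine (SolidTIBF.memLE_sum _ fun l hl => (hh l hl).norm).mono (le_of_eq ?_)
    rw [Finset.sum_const, nsmul_eq_mul, mul_assoc]
  · rw [Finset.sum_apply, ← Complex.ofReal_sum, Complex.norm_real,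
      Real.norm_of_nonneg (Finset.sum_nonneg fun _ _ => norm_nonneg _)]
    calc ‖iteratedFDeriv ℝ k u (x - t)‖ * w n x
        ≤ (∑ l ∈ wordsUpTo d k, ‖listDeriv l u (x - t)‖) * w n x := by
          gcongr
          · exact (hw.pos n x).le
          · exact norm_iteratedFDeriv_le_sum_wordsUpTo le_rfl hu _
      _ ≤ _ := by
          rw [Finset.sum_mul]
          exact Finset.sum_le_sum fun l hl => hh' l hl x t ht

/-- Uniform bounds for the derivatives of elements of `E^∞_W`. -/
theorem exists_norm_iteratedFDeriv_le_of_gsBound (E : SolidTIBF d B) (hw : IsWeightSystem w)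
    (k : ℕ) :
    ∃ (m : ℕ) (C : ℝ), 0 ≤ C ∧ ∀ (u : Rn d → ℂ) (M : ℝ), ContDiff ℝ ∞ u → GSBound E w m M u →
      ∀ x, ‖iteratedFDeriv ℝ k u x‖ ≤ C * M := by
  obtain ⟨Cs, hCs, hsob⟩ := exists_norm_le_sum_setIntegral_listDeriv d
  obtain ⟨C2, hC2, hE⟩ := E.exists_setIntegral_closedBall_le_norm
  have key : ∀ (v : Rn d → ℂ) (M : ℝ), ContDiff ℝ ∞ v → GSBound E w (d + 1) M v →
      ∀ x, ‖v x‖ ≤ Cs * ((wordsUpTo d (d + 1)).card * (C2 * M)) := by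
    intro v M hv hM x
    refine (hsob v hv x).trans ?_
    gcongr
    rw [← nsmul_eq_mul]
    refine Finset.sum_le_card_nsmul _ _ _ fun l hl => ?_
    refine le_trans ?_ (hE _ _ (hM l (length_le_of_mem_wordsUpTo hl)) x)
    refine setIntegral_mono ?_ ?_ fun y => ?_
    · exact (contDiff_listDeriv hv l).continuous.norm.continuousOn.integrableOn_compact
        (isCompact_closedBall _ _)
    · exact ((hM l (length_le_of_mem_wordsUpTo hl)).locallyIntegrable.integrableOn_isCompact
        (isCompact_closedBall _ _)).norm
    · beta_reduce
      rw [norm_mul_weight hw]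
      exact le_mul_of_one_le_right (norm_nonneg _) (hw.one_le _ _)
  refine ⟨d + 1 + k, (wordsUpTo d k).card * (Cs * ((wordsUpTo d (d + 1)).card * C2)),
    by positivity, fun u M hu hM x => ?_⟩
  refine (norm_iteratedFDeriv_le_sum_wordsUpTo le_rfl hu x).trans ?_
  refine (Finset.sum_le_card_nsmul _ _ _ fun l hl => key (listDeriv l u) M
    (contDiff_listDeriv hu l) (hM.listDeriv hw hu (length_le_of_mem_wordsUpTo hl)) x).trans
    (le_of_eq ?_)
  rw [nsmul_eq_mul]
  ring

/-! ### Membership and boundedness in `E^∞_W` -/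

theorem mem_weightedSpace_of_gsBound {n : ℕ} {M : ℝ} {u : Rn d → ℂ} (hu : ContDiff ℝ ∞ u)
    (h : GSBound E w n M u) : u ∈ weightedSpace E (w n) n := by
  refine ⟨hu.of_le (by exact_mod_cast le_top), fun k hk i => ?_⟩
  obtain ⟨e, he, -⟩ := h (List.ofFn i) (by simpa using hk)
  rw [← partialDeriv_eq_listDeriv hu] at he
  exact ⟨e, he⟩

theorem contDiff_of_mem_gelfandShilov {u : Rn d → ℂ} (hu : u ∈ gelfandShilov E w) :
    ContDiff ℝ ∞ u := by
  rw [contDiff_infty]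
  intro n
  exact ((Submodule.mem_iInf _).1 hu n).1

theorem gelfandShilovNorms_le_iff {n : ℕ} {M : ℝ} (hM : 0 ≤ M) (u : gelfandShilov E w) :
    gelfandShilovNorms E w n u ≤ M ↔ GSBound E w n M u := by
  have hu := contDiff_of_mem_gelfandShilov u.2
  set v : weightedSpace E (w n) n :=
    Submodule.inclusion (iInf_le (fun n => weightedSpace E (w n) n) n) u with hv
  have h1 : gelfandShilovNorms E w n u = weightedNorm E (w n) n v := rfl
  have hvu : (v : Rn d → ℂ) = u := rfl
  rw [h1, weightedNorm]
  constructor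
  · intro h l hl
    let i : Σ k : Fin (n + 1), (Fin k → Fin d) := ⟨⟨l.length, by omega⟩, l.get⟩
    refine ⟨weightedDeriv E (w n) n i v, ?_, ?_⟩
    · refine (incl_weightedDeriv E (w n) n i v).trans (Filter.EventuallyEq.of_eq ?_)
      ext x
      rw [hvu, partialDeriv_eq_listDeriv hu]
      simp only [i, List.ofFn_get]
    · refine le_trans ?_ h
      exact Seminorm.le_finset_sup_apply (p := fun i =>
        (normSeminorm ℂ B).comp (weightedDeriv E (w n) n i)) (Finset.mem_univ i)
  · intro h
    refine Seminorm.finset_sup_apply_le hM fun i _ => ?_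
    obtain ⟨e, he, hec⟩ := h (List.ofFn i.2) (by simpa using Nat.lt_succ_iff.mp i.1.2)
    have : weightedDeriv E (w n) n i v = e := by
      apply E.incl_injective
      refine AEEqFun.ext ((incl_weightedDeriv E (w n) n i v).trans ?_)
      rw [hvu, partialDeriv_eq_listDeriv hu]
      exact he.symm
    change ‖weightedDeriv E (w n) n i v‖ ≤ M
    rwa [this]

theorem mem_gelfandShilov_iff {u : Rn d → ℂ} :
    u ∈ gelfandShilov E w ↔ ContDiff ℝ ∞ u ∧ ∀ n, ∃ M, GSBound E w n M u := by
  constructor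
  · intro h
    refine ⟨contDiff_of_mem_gelfandShilov h, fun n => ⟨gelfandShilovNorms E w n ⟨u, h⟩, ?_⟩⟩
    exact (gelfandShilovNorms_le_iff (apply_nonneg _ _) ⟨u, h⟩).1 le_rfl
  · rintro ⟨hu, h⟩
    rw [gelfandShilov, Submodule.mem_iInf]
    intro n
    obtain ⟨M, hM⟩ := h n
    exact mem_weightedSpace_of_gsBound hu hM

theorem boundedInGS_iff {S : Set (Rn d → ℂ)} :
    BoundedInGS E w S ↔
      (∀ u ∈ S, ContDiff ℝ ∞ u) ∧ ∀ n, ∃ M, ∀ u ∈ S, GSBound E w n M u := by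
  let _ := gelfandShilovTopology E w
  have hp : WithSeminorms (gelfandShilovNorms E w) := ⟨rfl⟩
  have hiff := hp.isVonNBounded_iff_seminorm_bounded
    (s := {g : gelfandShilov E w | (g : Rn d → ℂ) ∈ S})
  constructor
  · rintro ⟨hS, hb⟩
    refine ⟨fun u hu => contDiff_of_mem_gelfandShilov (hS hu), fun n => ?_⟩
    obtain ⟨r, hr, h⟩ := hiff.1 hb n
    exact ⟨r, fun u hu => (gelfandShilovNorms_le_iff hr.le ⟨u, hS hu⟩).1 (h ⟨u, hS hu⟩ hu).le⟩
  · rintro ⟨hS, hb⟩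
    choose M hM using hb
    refine ⟨fun u hu => mem_gelfandShilov_iff.2 ⟨hS u hu, fun n => ⟨M n, hM n u hu⟩⟩, ?_⟩
    refine hiff.2 fun n => ⟨|M n| + 1, by positivity, fun u hu => ?_⟩
    have h1 := (gelfandShilovNorms_le_iff (abs_nonneg (M n)) u).2
      ((hM n u hu).mono (le_abs_self _))
    linarith

end Weighted

/-! ### Gain from vanishing moments -/

section Moments

variable {d : ℕ}

theorem VanishingMoments.integral_prod_mul {L k : ℕ} {ψ : TestFn d} (h : VanishingMoments L ψ)
    (hk : k < L) (i : Fin k → Fin d) : ∫ y : Rn d, (∏ l, (y (i l) : ℂ)) * ψ y = 0 := by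
  classical
  have := h (fun a => (Finset.univ.filter fun l => i l = a).card) (by
    rw [← Finset.card_eq_sum_card_fiberwise (f := i) (s := Finset.univ) (t := Finset.univ)
      (fun _ _ => Finset.mem_coe.2 (Finset.mem_univ _))]
    simpa using hk)
  rw [← this]
  refine integral_congr_ae (Filter.Eventually.of_forall fun y => ?_)
  beta_reduce
  congr 1
  rw [← Finset.prod_fiberwise' Finset.univ i (fun a => (y a : ℂ))]
  simp

/-- Against a function with vanishing moments of order less than `L`, only the remainder of order
`L` of the Taylor expansion contributes; at scale `2^{-j}` it is of size `2^{-jL}`. -/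
theorem exists_norm_convolution_dilate_le {L : ℕ} {ψ : TestFn d} (hψ : VanishingMoments L ψ)
    {R : ℝ} (hR : 0 ≤ R) (hsupp : tsupport ψ ⊆ Metric.closedBall 0 R) :
    ∃ C : ℝ, 0 ≤ C ∧ ∀ v : Rn d → ℂ, ContDiff ℝ ∞ v → ∀ (j : ℕ) (x : Rn d) (S : ℝ),
      (∀ t, ‖t‖ ≤ R → ‖iteratedFDeriv ℝ L v (x - t)‖ ≤ S) →
      ‖(v ⋆[ContinuousLinearMap.mul ℂ ℂ] dilate j ψ) x‖ ≤ C * ((2 : ℝ) ^ j)⁻¹ ^ L * S := by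
  have hψi : Integrable ψ := ψ.continuous.integrable_of_hasCompactSupport ψ.hasCompactSupport
  refine ⟨R ^ L * ∫ y, ‖ψ y‖, by positivity, fun v hv j x S hS => ?_⟩
  set ε := ((2 : ℝ) ^ j)⁻¹ with hε
  have hε0 : 0 < ε := by positivity
  have hε1 : ε ≤ 1 := inv_le_one_of_one_le₀ (one_le_pow₀ one_le_two)
  have hS0 : 0 ≤ S := (norm_nonneg _).trans (hS 0 (by simpa using hR))
  have hconv : (v ⋆[ContinuousLinearMap.mul ℂ ℂ] dilate j ψ) x
      = ∫ y, v (x + -(ε • y)) * ψ y := by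
    rw [convolution_eq_swap]
    have := integral_dilate_comp j ψ (fun t => v (x - t))
    simp only [ContinuousLinearMap.mul_apply', ← sub_eq_add_neg]
    exact this
  rw [hconv]
  -- the Taylor polynomial contributes nothing
  let P : Rn d → ℂ := fun y => ∑ k ∈ Finset.range L,
    ((k.factorial : ℝ)⁻¹) • iteratedFDeriv ℝ k v x (fun _ => -(ε • y))
  have hPk : ∀ k ∈ Finset.range L, ∀ y : Rn d,
      ((k.factorial : ℝ)⁻¹) • iteratedFDeriv ℝ k v x (fun _ => -(ε • y)) * ψ y
      = ∑ i : Fin k → Fin d, (((k.factorial : ℝ)⁻¹ * (-ε) ^ k : ℝ) * partialDeriv i v x) *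
        ((∏ l, (y (i l) : ℂ)) * ψ y) := by
    intro k _ y
    rw [iteratedFDeriv_apply_eq_sum, Finset.smul_sum, Finset.sum_mul]
    refine Finset.sum_congr rfl fun i _ => ?_
    have h1 : ∏ l : Fin k, (-(ε • y)) (i l) = (-ε) ^ k * ∏ l, y (i l) := by
      rw [show (-ε) ^ k = ∏ _l : Fin k, (-ε) by simp, ← Finset.prod_mul_distrib]
      refine Finset.prod_congr rfl fun l _ => ?_
      simp
    rw [h1, Complex.real_smul, Complex.real_smul]
    push_cast
    ring
  have hmonint : ∀ (k : ℕ) (i : Fin k → Fin d),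
      Integrable (fun y : Rn d => (∏ l, (y (i l) : ℂ)) * ψ y) := by
    intro k i
    refine Continuous.integrable_of_hasCompactSupport ?_ ψ.hasCompactSupport.mul_left
    refine Continuous.mul (continuous_finsetProd _ fun l _ => ?_) ψ.continuous
    exact Complex.continuous_ofReal.comp (by fun_prop)
  have hPint : Integrable (fun y => P y * ψ y) := by
    simp only [P, Finset.sum_mul]
    refine integrable_finsetSum _ fun k hk => ?_
    simp_rw [hPk k hk]
    exact integrable_finsetSum _ fun i _ => (hmonint k i).const_mul _
  have hP0 : ∫ y, P y * ψ y = 0 := by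
    simp only [P, Finset.sum_mul]
    rw [integral_finsetSum]
    · refine Finset.sum_eq_zero fun k hk => ?_
      simp_rw [hPk k hk]
      rw [integral_finsetSum _ fun i _ => (hmonint k i).const_mul _]
      refine Finset.sum_eq_zero fun i _ => ?_
      rw [integral_const_mul, hψ.integral_prod_mul (Finset.mem_range.1 hk), mul_zero]
    · intro k hk
      simp_rw [hPk k hk]
      exact integrable_finsetSum _ fun i _ => (hmonint k i).const_mul _
  have hvint : Integrable (fun y => v (x + -(ε • y)) * ψ y) := by
    refine Continuous.integrable_of_hasCompactSupport ?_ ψ.hasCompactSupport.mul_left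
    exact (hv.continuous.comp (by fun_prop)).mul ψ.continuous
  have hrem : ∀ y, ‖y‖ ≤ R → ‖v (x + -(ε • y)) - P y‖ ≤ (ε * R) ^ L * S := by
    intro y hy
    have hεy : ‖-(ε • y)‖ ≤ ε * R := by
      rw [norm_neg, norm_smul, Real.norm_of_nonneg hε0.le]
      gcongr
    cases L with
    | zero =>
      have := hS (ε • y) (by
        rw [← norm_neg]
        exact hεy.trans (mul_le_of_le_one_left hR hε1))
      simpa [P, norm_iteratedFDeriv_zero, ← sub_eq_add_neg] using this
    | succ n =>
      rw [map_add_eq_sum_add_integral_iteratedFDeriv (n := n)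
        (fun t _ => hv.contDiffAt.of_le (by exact_mod_cast le_top))]
      simp only [P, add_sub_cancel_left]
      rw [norm_smul, norm_inv, Real.norm_of_nonneg (by positivity)]
      have h1 : ‖∫ t in (0 : ℝ)..1, (1 - t) ^ n • iteratedFDeriv ℝ (n + 1) v
          (x + t • -(ε • y)) (fun _ => -(ε • y))‖ ≤ (ε * R) ^ (n + 1) * S := by
        have := intervalIntegral.norm_integral_le_of_norm_le_const (a := (0 : ℝ)) (b := 1)
          (C := (ε * R) ^ (n + 1) * S) (f := fun t => (1 - t) ^ n •
            iteratedFDeriv ℝ (n + 1) v (x + t • -(ε • y)) (fun _ => -(ε • y))) ?_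
        · simpa using this
        · intro t ht
          rw [uIoc_of_le zero_le_one] at ht
          rw [norm_smul, norm_pow, Real.norm_of_nonneg (by linarith [ht.2])]
          have h2 : (1 - t) ^ n ≤ 1 := pow_le_one₀ (by linarith [ht.2]) (by linarith [ht.1])
          have h3 : ‖iteratedFDeriv ℝ (n + 1) v (x + t • -(ε • y))‖ ≤ S := by
            have := hS (t • (ε • y)) (by
              rw [norm_smul, Real.norm_of_nonneg ht.1.le, ← norm_neg (ε • y)]
              calc t * ‖-(ε • y)‖ ≤ 1 * (1 * R) := by
                    gcongr
                    · exact ht.2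
                    · exact hεy.trans (by gcongr)
                _ = R := by ring)
            rwa [smul_neg, ← sub_eq_add_neg]
          have h4 : ‖iteratedFDeriv ℝ (n + 1) v (x + t • -(ε • y)) (fun _ => -(ε • y))‖
              ≤ S * (ε * R) ^ (n + 1) := by
            refine (ContinuousMultilinearMap.le_opNorm _ _).trans ?_
            rw [Finset.prod_const, Finset.card_univ, Fintype.card_fin]
            gcongr
          calc _ ≤ 1 * (S * (ε * R) ^ (n + 1)) := by gcongr
            _ = _ := by ring
      have h5 : ((n.factorial : ℝ))⁻¹ ≤ 1 :=
        inv_le_one_of_one_le₀ (by exact_mod_cast n.factorial_pos)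
      calc _ ≤ 1 * ((ε * R) ^ (n + 1) * S) := by gcongr
        _ = _ := one_mul _
  calc ‖∫ y, v (x + -(ε • y)) * ψ y‖
      = ‖∫ y, (v (x + -(ε • y)) - P y) * ψ y‖ := by
        simp_rw [sub_mul]
        rw [integral_sub hvint hPint, hP0, sub_zero]
    _ ≤ ∫ y, (ε * R) ^ L * S * ‖ψ y‖ := by
        refine norm_integral_le_of_norm_le (hψi.norm.const_mul _)
          (Filter.Eventually.of_forall fun y => ?_)
        rw [norm_mul]
        by_cases hy : y ∈ tsupport ψ
        · gcongr
          exact hrem y (mem_closedBall_zero_iff.1 (hsupp hy))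
        · simp [image_eq_zero_of_notMem_tsupport hy]
    _ = R ^ L * (∫ y, ‖ψ y‖) * ε ^ L * S := by
        rw [integral_const_mul]
        ring

end Moments

/-! ### Convolution with dilated test functions in `E^∞_W` -/

section ConvolutionBounds

variable {d : ℕ} {B : Type*} [NormedAddCommGroup B] [NormedSpace ℂ B]
variable {E : SolidTIBF d B} {w : ℕ → Rn d → ℝ}

theorem contDiff_convolution_test {u : Rn d → ℂ} (hu : Continuous u) (ψ : TestFn d) :
    ContDiff ℝ ∞ (u ⋆[ContinuousLinearMap.mul ℂ ℂ] ψ) :=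
  contDiff_convolution hu.locallyIntegrable ψ.contDiff ψ.hasCompactSupport

/-- Convolution with `ψ_j` maps `E^∞_W` to itself, with bounds of size `2^{-jL}` if the moments of
`ψ` of order less than `L` vanish. -/
theorem exists_gsBound_convolution_dilate [CompleteSpace B] (E : SolidTIBF d B)
    (hw : IsWeightSystem w) (hwM : WeakModerate w) (n : ℕ) {L : ℕ} {ψ : TestFn d}
    (hψ : VanishingMoments L ψ) :
    ∃ (m : ℕ) (C : ℝ), 0 ≤ C ∧ ∀ (u : Rn d → ℂ) (M : ℝ), ContDiff ℝ ∞ u → GSBound E w m M u →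
      ∀ j : ℕ, GSBound E w n (C * ((2 : ℝ) ^ j)⁻¹ ^ L * M)
        (u ⋆[ContinuousLinearMap.mul ℂ ℂ] dilate j ψ) := by
  obtain ⟨R₀, hR₀⟩ := ψ.hasCompactSupport.isBounded.subset_closedBall (0 : Rn d)
  set R := max R₀ 0
  have hR : 0 ≤ R := le_max_right _ _
  obtain ⟨C1, hC1, hmom⟩ := exists_norm_convolution_dilate_le hψ hR
    (hR₀.trans (Metric.closedBall_subset_closedBall (le_max_left _ _)))
  obtain ⟨m, C2, hC2, hdom⟩ := exists_dominating_iteratedFDeriv_of_gsBound E hw hwM n L hR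
  refine ⟨m + n, C1 * C2, by positivity, fun u M hu hM j l hl => ?_⟩
  have hlu := contDiff_listDeriv hu l
  obtain ⟨h, hh, hh'⟩ := hdom (listDeriv l u) M hlu (hM.listDeriv hw hu hl)
  set q := ((2 : ℝ) ^ j)⁻¹ ^ L
  have hq : 0 ≤ q := by positivity
  have h1 : E.MemLE (((C1 * q : ℝ) : ℂ) • h) (C1 * C2 * q * M) := by
    refine (hh.smul _).mono (le_of_eq ?_)
    rw [Complex.norm_real, Real.norm_of_nonneg (by positivity)]
    ring
  refine h1.of_norm_le (aestronglyMeasurable_mul_weight hw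
    (contDiff_listDeriv (contDiff_convolution_test hu.continuous _) l).continuous n)
    (Filter.Eventually.of_forall fun x => ?_)
  rw [norm_mul_weight hw, listDeriv_convolution_left hu (dilate j ψ).contDiff
    (dilate j ψ).hasCompactSupport, Pi.smul_apply, norm_smul, Complex.norm_real,
    Real.norm_of_nonneg (by positivity), ← le_div_iff₀ (hw.pos n x), mul_div_assoc]
  refine hmom (listDeriv l u) hlu j x (‖h x‖ / w n x) fun t ht => ?_
  rw [le_div_iff₀ (hw.pos n x)]
  exact hh' x t ht

/-- The Laplacian of a test function. -/
def testLaplacian (ψ : TestFn d) : TestFn d where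
  toFun := ∑ a : Fin d, listDeriv [a, a] ψ
  contDiff' := by
    have : ContDiff ℝ ∞ (fun x => ∑ a : Fin d, listDeriv [a, a] ψ x) :=
      ContDiff.sum fun a _ => contDiff_listDeriv ψ.contDiff _
    convert this using 1
    ext x
    simp
  hasCompactSupport' := by
    refine HasCompactSupport.of_support_subset_isCompact ψ.hasCompactSupport ?_
    intro x hx
    by_contra h
    refine hx ?_
    rw [Finset.sum_apply]
    refine Finset.sum_eq_zero fun a _ => image_eq_zero_of_notMem_tsupport fun h' => h ?_
    exact (tsupport_fderiv_apply_subset ℝ _).trans (tsupport_fderiv_apply_subset ℝ _) h'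
  tsupport_subset' := fun _ _ => trivial

theorem testLaplacian_apply (ψ : TestFn d) (x : Rn d) :
    testLaplacian ψ x = ∑ a : Fin d, listDeriv [a, a] ψ x := by
  change (∑ a : Fin d, listDeriv [a, a] ψ) x = _
  rw [Finset.sum_apply]

theorem coe_testLaplacian (ψ : TestFn d) : (testLaplacian ψ : Rn d → ℂ) = Δ (ψ : Rn d → ℂ) :=
  (laplacian_eq_sum_listDeriv ψ.contDiff).symm

theorem listDeriv_dilate (j : ℕ) (ψ : TestFn d) (l : List (Fin d)) (x : Rn d) :
    listDeriv l (dilate j ψ) x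
      = (2 : ℂ) ^ (j * l.length) * ((2 : ℂ) ^ (j * d) * listDeriv l ψ ((2 : ℝ) ^ j • x)) := by
  induction l generalizing x with
  | nil => simp
  | cons a l ih =>
    rw [listDeriv_cons, coordDeriv, funext ih]
    have hd : HasFDerivAt (fun x => listDeriv l ψ ((2 : ℝ) ^ j • x))
        ((2 : ℝ) ^ j • fderiv ℝ (listDeriv l ψ) ((2 : ℝ) ^ j • x)) x := by
      have h1 := ((contDiff_listDeriv ψ.contDiff l).differentiable (by simp)
        ((2 : ℝ) ^ j • x)).hasFDerivAt
      have h2 : HasFDerivAt (fun x : Rn d => (2 : ℝ) ^ j • x)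
          ((2 : ℝ) ^ j • ContinuousLinearMap.id ℝ (Rn d)) x :=
        (hasFDerivAt_id x).const_smul ((2 : ℝ) ^ j)
      have h3 := h1.comp x h2
      rwa [ContinuousLinearMap.comp_smul, ContinuousLinearMap.comp_id] at h3
    have := ((hd.const_mul ((2 : ℂ) ^ (j * d))).const_mul ((2 : ℂ) ^ (j * l.length))).fderiv
    rw [this]
    simp only [smul_apply, listDeriv_cons, coordDeriv, smul_eq_mul,
      List.length_cons, Complex.real_smul]
    push_cast
    ring

theorem dilate_testLaplacian (j : ℕ) (ψ : TestFn d) :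
    (dilate j (testLaplacian ψ) : Rn d → ℂ)
      = ((2 : ℂ) ^ (j * 2))⁻¹ • ∑ a : Fin d, listDeriv [a, a] (dilate j ψ) := by
  ext x
  rw [dilate_apply, testLaplacian_apply, Pi.smul_apply, Finset.sum_apply]
  simp_rw [listDeriv_dilate]
  simp only [List.length_cons, List.length_nil, zero_add, Nat.reduceAdd]
  rw [← Finset.mul_sum, ← Finset.mul_sum, smul_eq_mul]
  rw [inv_mul_cancel_left₀ (pow_ne_zero _ two_ne_zero)]

theorem convolution_finset_sum {ι : Type*} (s : Finset ι) {u : Rn d → ℂ} {g : ι → Rn d → ℂ}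
    (hu : Continuous u) (hg : ∀ i ∈ s, Continuous (g i)) (hc : ∀ i ∈ s, HasCompactSupport (g i)) :
    u ⋆[ContinuousLinearMap.mul ℂ ℂ] (∑ i ∈ s, g i)
      = ∑ i ∈ s, u ⋆[ContinuousLinearMap.mul ℂ ℂ] g i := by
  ext x
  rw [Finset.sum_apply]
  simp only [convolution, ContinuousLinearMap.mul_apply', Finset.sum_apply, Finset.mul_sum]
  refine integral_finsetSum _ fun i hi => ?_
  exact (hc i hi).convolutionExists_right (ContinuousLinearMap.mul ℂ ℂ) hu.locallyIntegrable
    (hg i hi) x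

theorem convolution_dilate_testLaplacian {u : Rn d → ℂ} (hu : ContDiff ℝ ∞ u) (j : ℕ)
    (ψ : TestFn d) :
    u ⋆[ContinuousLinearMap.mul ℂ ℂ] dilate j (testLaplacian ψ)
      = ((2 : ℂ) ^ (j * 2))⁻¹ • ∑ a : Fin d,
        listDeriv [a, a] u ⋆[ContinuousLinearMap.mul ℂ ℂ] dilate j ψ := by
  rw [dilate_testLaplacian, convolution_smul, convolution_finset_sum _ hu.continuous
    (fun a _ => (contDiff_listDeriv (dilate j ψ).contDiff _).continuous)
    (fun a _ => hasCompactSupport_listDeriv (dilate j ψ).hasCompactSupport _)]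
  congr 1
  refine Finset.sum_congr rfl fun a _ => ?_
  rw [← listDeriv_convolution_left hu (dilate j ψ).contDiff (dilate j ψ).hasCompactSupport,
    listDeriv_convolution_right hu.continuous.locallyIntegrable (dilate j ψ).contDiff
      (dilate j ψ).hasCompactSupport]

/-- The Laplacian is moved from `ψ` to `u`, so that the moments of `ψ` itself matter; the additional
factor `2^{-2j}` is not needed and is estimated by `1`. -/
theorem exists_gsBound_convolution_dilate_testLaplacian [CompleteSpace B] (E : SolidTIBF d B)
    (hw : IsWeightSystem w) (hwM : WeakModerate w) (n : ℕ) {L : ℕ} {ψ : TestFn d}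
    (hψ : VanishingMoments L ψ) :
    ∃ (m : ℕ) (C : ℝ), 0 ≤ C ∧ ∀ (u : Rn d → ℂ) (M : ℝ), ContDiff ℝ ∞ u → GSBound E w m M u →
      ∀ j : ℕ, GSBound E w n (C * ((2 : ℝ) ^ j)⁻¹ ^ L * M)
        (u ⋆[ContinuousLinearMap.mul ℂ ℂ] dilate j (testLaplacian ψ)) := by
  obtain ⟨m, C, hC, h⟩ := exists_gsBound_convolution_dilate E hw hwM n hψ
  refine ⟨m + 2, d * C, by positivity, fun u M hu hM j => ?_⟩
  rw [convolution_dilate_testLaplacian hu]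
  have h1 := gsBound_sum Finset.univ (fun a _ => contDiff_convolution_test
    (contDiff_listDeriv hu [a, a]).continuous (dilate j ψ)) (fun (a : Fin d) _ =>
      h (listDeriv [a, a] u) M (contDiff_listDeriv hu _) (hM.listDeriv hw hu (by simp)) j)
  have hsm : ContDiff ℝ ∞ (∑ a : Fin d,
      listDeriv [a, a] u ⋆[ContinuousLinearMap.mul ℂ ℂ] dilate j ψ) := by
    have : ContDiff ℝ ∞ (fun x => ∑ a : Fin d,
        (listDeriv [a, a] u ⋆[ContinuousLinearMap.mul ℂ ℂ] dilate j ψ) x) :=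
      ContDiff.sum fun a _ => contDiff_convolution_test
        (contDiff_listDeriv hu [a, a]).continuous (dilate j ψ)
    convert this using 1
    ext x
    simp
  have h2 : ‖((2 : ℂ) ^ (j * 2))⁻¹‖ ≤ 1 := by
    rw [norm_inv, norm_pow, Complex.norm_two]
    exact inv_le_one_of_one_le₀ (one_le_pow₀ one_le_two)
  have h3 := (GSBound.nonneg hM)
  refine (h1.smul hsm _).mono ?_
  calc _ ≤ 1 * ∑ a : Fin d, C * ((2 : ℝ) ^ j)⁻¹ ^ L * M := by
        gcongr
    _ = d * C * ((2 : ℝ) ^ j)⁻¹ ^ L * M := by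
        simp
        ring

/-! ### Series in `E^∞_W` -/

/-- Absolutely convergent series converge in `E^∞_W`, uniformly on `ℝ^d`. -/
theorem exists_sum_of_summable_gsBound [CompleteSpace B] (hw : IsWeightSystem w)
    {G : ℕ → Rn d → ℂ} (hG : ∀ j, ContDiff ℝ ∞ (G j)) {c : ℕ → ℕ → ℝ}
    (hc : ∀ n, Summable (c n)) (h : ∀ n j, GSBound E w n (c n j) (G j)) :
    (fun x => ∑' j, G j x) ∈ gelfandShilov E w ∧
      TendstoUniformly (fun N x => ∑ j ∈ Finset.range N, G j x) (fun x => ∑' j, G j x)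
        Filter.atTop := by
  have hsup := fun k : ℕ => exists_norm_iteratedFDeriv_le_of_gsBound E hw k
  choose m C hC hbd using hsup
  have hv : ∀ k : ℕ, Summable fun j => C k * c (m k) j := fun k => (hc (m k)).mul_left _
  have hGb : ∀ (k : ℕ) (j : ℕ) (x : Rn d), ‖iteratedFDeriv ℝ k (G j) x‖ ≤ C k * c (m k) j :=
    fun k j x => hbd k (G j) _ (hG j) (h _ j) x
  have hsm : ContDiff ℝ ∞ (fun x => ∑' j, G j x) :=
    contDiff_tsum (N := ⊤) hG (fun k _ => hv k) (fun k j x _ => hGb k j x)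
  have hpd : ∀ (k : ℕ) (x : Rn d), iteratedFDeriv ℝ k (fun x => ∑' j, G j x) x
      = ∑' j, iteratedFDeriv ℝ k (G j) x := fun k x =>
    iteratedFDeriv_tsum_apply (N := ⊤) hG (fun k _ => hv k) (fun k j x _ => hGb k j x) le_top x
  refine ⟨mem_gelfandShilov_iff.2 ⟨hsm, fun n => ⟨∑' j, c n j, fun l hl => ?_⟩⟩, ?_⟩
  · have hl' : ∀ {u : Rn d → ℂ}, ContDiff ℝ ∞ u → listDeriv l u = partialDeriv l.get u :=
      fun hu => by rw [partialDeriv_eq_listDeriv hu, List.ofFn_get]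
    choose e he hec using fun j => h n j l hl
    have hes : Summable e := Summable.of_norm_bounded (hc n) hec
    refine ⟨∑' j, e j, ?_, ?_⟩
    · refine E.incl_eq_of_tendsto hes.hasSum.tendsto_sum_nat ?_
      have hsum : ∀ N, E.incl (∑ j ∈ Finset.range N, e j) =ᵐ[volume]
          fun x => ∑ j ∈ Finset.range N, listDeriv l (G j) x * (w n x : ℂ) := by
        intro N
        induction N with
        | zero =>
          simp only [Finset.range_zero, Finset.sum_empty, map_zero]
          exact AEEqFun.coeFn_zero
        | succ N ih =>
          rw [Finset.sum_range_succ, map_add]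
          simp_rw [Finset.sum_range_succ]
          filter_upwards [AEEqFun.coeFn_add (E.incl (∑ j ∈ Finset.range N, e j)) (E.incl (e N)),
            ih, he N] with x h1 h2 h3
          rw [h1, Pi.add_apply, h2, h3]
      filter_upwards [ae_all_iff.2 hsum] with x hx
      simp_rw [hx, ← Finset.sum_mul]
      refine Filter.Tendsto.mul_const _ ?_
      rw [hl' hsm]
      simp_rw [fun j => hl' (hG j)]
      unfold partialDeriv
      rw [hpd]
      have hs : Summable fun j => iteratedFDeriv ℝ l.length (G j) x :=
        Summable.of_norm_bounded (hv _) fun j => hGb _ j x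
      have := ((ContinuousMultilinearMap.apply ℝ (fun _ : Fin l.length => Rn d) ℂ
        (fun i => EuclideanSpace.single (l.get i) 1)).hasSum hs.hasSum).tendsto_sum_nat
      exact this
    · exact tsum_of_norm_bounded (hc n).hasSum hec
  · refine tendstoUniformly_tsum_nat (hv 0) fun j x => ?_
    have := hGb 0 j x
    rwa [norm_iteratedFDeriv_zero] at this

end ConvolutionBounds

/-! ### Growth of regularizations and the telescoping series -/

section Conditions

variable {d : ℕ} {B : Type*} [NormedAddCommGroup B] [NormedSpace ℂ B]
variable {E : SolidTIBF d B} {w : ℕ → Rn d → ℝ}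

theorem distrConv_add (f : Distr d) (φ ψ : TestFn d) :
    distrConv f (φ + ψ) = distrConv f φ + distrConv f ψ := by
  ext x
  have : reflTranslate (φ + ψ) x = reflTranslate φ x + reflTranslate ψ x := rfl
  simp [distrConv, this]

theorem distrConv_sub (f : Distr d) (φ ψ : TestFn d) :
    distrConv f (φ - ψ) = distrConv f φ - distrConv f ψ := by
  ext x
  have : reflTranslate (φ - ψ) x = reflTranslate φ x - reflTranslate ψ x := rfl
  simp [distrConv, this]

theorem dilate_add (j : ℕ) (φ ψ : TestFn d) : dilate j (φ + ψ) = dilate j φ + dilate j ψ := by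
  ext x
  change (2 : ℂ) ^ (j * d) * (φ _ + ψ _) = (2 : ℂ) ^ (j * d) * φ _ + (2 : ℂ) ^ (j * d) * ψ _
  ring

theorem dilate_testConvolution (j : ℕ) (φ ψ : TestFn d) :
    dilate j (testConvolution φ ψ) = testConvolution (dilate j φ) (dilate j ψ) := by
  ext x
  rw [dilate_apply, testConvolution_apply, testConvolution_apply]
  have h := integral_dilate_comp j φ (fun y => dilate j ψ (x - y))
  simp_rw [mul_comm (dilate j φ _)]
  rw [h, ← integral_const_mul]
  refine integral_congr_ae (Filter.Eventually.of_forall fun z => ?_)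
  simp only [dilate_apply, smul_sub, smul_smul]
  rw [mul_inv_cancel₀ (by positivity), one_smul]
  ring

/-- The regularizations `f * φ_j` of an element `f` of `E^∞_W` form a bounded set. -/
theorem boundedInGS_of_distrMemGS [CompleteSpace B] (hw : IsWeightSystem w)
    (hwM : WeakModerate w) {f : Distr d} (hf : DistrMemGS E w f) (φ : TestFn d) :
    BoundedInGS E w {g | ∃ j : ℕ, g = distrConv f (dilate j φ)} := by
  obtain ⟨g, hg, hfg⟩ := hf
  rw [mem_gelfandShilov_iff] at hg
  have hconv : ∀ ψ : TestFn d, distrConv f ψ = g ⋆[ContinuousLinearMap.mul ℂ ℂ] ψ := by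
    intro ψ
    ext x
    rw [distrConv, hfg]
    rfl
  rw [boundedInGS_iff]
  refine ⟨?_, fun n => ?_⟩
  · rintro _ ⟨j, rfl⟩
    rw [hconv]
    exact contDiff_convolution_test hg.1.continuous _
  · obtain ⟨m, C, hC, h⟩ := exists_gsBound_convolution_dilate E hw hwM n (L := 0) (ψ := φ)
      (fun α hα => absurd hα (Nat.not_lt_zero _))
    obtain ⟨M, hM⟩ := hg.2 m
    refine ⟨C * M, ?_⟩
    rintro _ ⟨j, rfl⟩
    rw [hconv]
    simpa using h g M hg.1 hM j

theorem real_smul_eq_complex_smul (a : ℝ) (u : Rn d → ℂ) : a • u = (a : ℂ) • u := by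
  ext x
  simp

theorem norm_two_rpow_neg_le_one {r : ℝ} (hr : 0 < r) (j : ℕ) :
    ‖(((2 : ℝ) ^ (-r * (j : ℝ)) : ℝ) : ℂ)‖ ≤ 1 := by
  rw [Complex.norm_real, Real.norm_of_nonneg (by positivity)]
  refine Real.rpow_le_one_of_one_le_of_nonpos one_le_two ?_
  have : 0 ≤ r * j := by positivity
  linarith

theorem boundedInGS_rpow_smul {v : ℕ → Rn d → ℂ} {r : ℝ} (hr : 0 < r)
    (h : BoundedInGS E w {g | ∃ j : ℕ, g = v j}) :
    BoundedInGS E w {g | ∃ j : ℕ, g = ((2 : ℝ) ^ (-r * (j : ℝ))) • v j} := by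
  rw [boundedInGS_iff] at h ⊢
  refine ⟨?_, fun n => ?_⟩
  · rintro _ ⟨j, rfl⟩
    exact contDiff_const.smul (h.1 _ ⟨j, rfl⟩)
  · obtain ⟨M, hM⟩ := h.2 n
    refine ⟨M, ?_⟩
    rintro _ ⟨j, rfl⟩
    rw [real_smul_eq_complex_smul]
    have hj := hM _ ⟨j, rfl⟩
    refine (hj.smul (h.1 _ ⟨j, rfl⟩) _).mono ?_
    exact mul_le_of_le_one_left hj.nonneg (norm_two_rpow_neg_le_one hr j)

/-- Two families with growth exponents `r 0` and `r 1` have the common exponent `r 0 + r 1`. -/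
theorem boundedInGS_rpow_smul_add {v : Fin 2 → ℕ → Rn d → ℂ} {r : Fin 2 → ℝ}
    (hr : ∀ l, 0 < r l)
    (h : ∀ l, BoundedInGS E w {g | ∃ j : ℕ, g = ((2 : ℝ) ^ (-r l * (j : ℝ))) • v l j}) :
    BoundedInGS E w {g | ∃ (j : ℕ) (l : Fin 2),
      g = ((2 : ℝ) ^ (-(r 0 + r 1) * (j : ℝ))) • v l j} := by
  have hl : ∀ l, BoundedInGS E w
      {g | ∃ j : ℕ, g = ((2 : ℝ) ^ (-(r 0 + r 1) * (j : ℝ))) • v l j} := by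
    intro l
    have hl' := boundedInGS_rpow_smul (v := fun j => ((2 : ℝ) ^ (-r l * (j : ℝ))) • v l j)
      (hr (1 - l)) (h l)
    have hsum : r 0 + r 1 = r (1 - l) + r l := by
      fin_cases l
      · simp [add_comm]
      · simp
    have he : ∀ j : ℕ, ((2 : ℝ) ^ (-r (1 - l) * (j : ℝ))) • ((2 : ℝ) ^ (-r l * (j : ℝ))) • v l j
        = ((2 : ℝ) ^ (-(r 0 + r 1) * (j : ℝ))) • v l j := by
      intro j
      rw [smul_smul, ← Real.rpow_add two_pos, hsum]
      congr 2
      ring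
    simp_rw [he] at hl'
    exact hl'
  simp_rw [boundedInGS_iff] at hl ⊢
  refine ⟨?_, fun n => ?_⟩
  · rintro _ ⟨j, l, rfl⟩
    exact (hl l).1 _ ⟨j, rfl⟩
  · choose M hM using fun l => (hl l).2 n
    refine ⟨max (M 0) (M 1), ?_⟩
    rintro _ ⟨j, l, rfl⟩
    refine (hM l _ ⟨j, rfl⟩).mono ?_
    fin_cases l
    · exact le_max_left _ _
    · exact le_max_right _ _

theorem testLaplacian_add (φ ψ : TestFn d) :
    testLaplacian (φ + ψ) = testLaplacian φ + testLaplacian ψ := by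
  ext x
  change testLaplacian (φ + ψ) x = testLaplacian φ x + testLaplacian ψ x
  simp_rw [testLaplacian_apply, ← Finset.sum_add_distrib]
  refine Finset.sum_congr rfl fun a _ => ?_
  exact congrFun (listDeriv_add φ.contDiff ψ.contDiff [a, a]) x

theorem testLaplacian_testConvolution (χ ψ : TestFn d) :
    testLaplacian (testConvolution χ ψ) = testConvolution χ (testLaplacian ψ) := by
  ext x
  rw [testLaplacian_apply]
  simp_rw [listDeriv_testConvolution]
  have h := convolution_finset_sum Finset.univ χ.continuous
    (g := fun a : Fin d => listDeriv [a, a] ψ)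
    (fun a _ => (contDiff_listDeriv ψ.contDiff _).continuous)
    (fun a _ => hasCompactSupport_listDeriv ψ.hasCompactSupport _)
  have h2 := congrFun h x
  rw [Finset.sum_apply] at h2
  exact h2.symm

/-- If `φ = χ⁰ * φ⁰ + χ¹ * φ¹`, then `f * φ_j = (f * χ⁰_j) * φ⁰_j + (f * χ¹_j) * φ¹_j`. -/
theorem distrConv_dilate_of_eq {χ : Fin 2 → TestFn d} {φ : TestFn d} {φ' : Fin 2 → TestFn d}
    (h : φ = testConvolution (χ 0) (φ' 0) + testConvolution (χ 1) (φ' 1)) (f : Distr d) (j : ℕ) :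
    distrConv f (dilate j φ)
      = distrConv f (dilate j (χ 0)) ⋆[ContinuousLinearMap.mul ℂ ℂ] dilate j (φ' 0)
        + distrConv f (dilate j (χ 1)) ⋆[ContinuousLinearMap.mul ℂ ℂ] dilate j (φ' 1) := by
  rw [h, dilate_add, distrConv_add, dilate_testConvolution, dilate_testConvolution,
    distrConv_testConvolution, distrConv_testConvolution]

theorem dilate_succ_sub_dilate {φ ψ : TestFn d}
    (h : ∀ x : Rn d, (2 : ℂ) ^ d * φ ((2 : ℝ) • x) - φ x = (Δ (ψ : Rn d → ℂ)) x) (j : ℕ) :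
    dilate (j + 1) φ - dilate j φ = dilate j (testLaplacian ψ) := by
  ext x
  change dilate (j + 1) φ x - dilate j φ x = _
  simp only [dilate_apply]
  rw [congrFun (coe_testLaplacian ψ) ((2 : ℝ) ^ j • x), ← h, smul_smul, ← pow_succ']
  ring

theorem inv_two_pow_mul_rpow_le {r : ℝ} {L : ℕ} (hL : r + 1 ≤ L) (j : ℕ) :
    ((2 : ℝ) ^ j)⁻¹ ^ L * (2 : ℝ) ^ (r * (j : ℝ)) ≤ (1 / 2) ^ j := by
  have h1 : ((2 : ℝ) ^ j)⁻¹ ^ L = (2 : ℝ) ^ (-(j * L : ℝ)) := by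
    rw [Real.rpow_neg two_pos.le, inv_pow, ← pow_mul]
    norm_cast
  have h2 : (1 / 2 : ℝ) ^ j = (2 : ℝ) ^ (-(j : ℝ)) := by
    rw [Real.rpow_neg two_pos.le, Real.rpow_natCast, one_div, inv_pow]
  rw [h1, h2, ← Real.rpow_add two_pos]
  refine Real.rpow_le_rpow_of_exponent_le one_le_two ?_
  have : (r + 1) * (j : ℝ) ≤ L * j := by gcongr
  linarith

/-- A distribution with polynomially growing `f * χ^ℓ_j` belongs to `E^∞_W`: the telescoping series
`f = f * φ_0 + ∑ (f * φ_{j+1} - f * φ_j)` converges absolutely in `E^∞_W`, because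
`φ_{j+1} - φ_j = (Δψ)_j` and the moments of `ψ` of order less than `L` vanish, where `L ≥ r + 1`
for the growth exponent `r`. -/
theorem distrMemGS_of_boundedInGS [CompleteSpace B] (hw : IsWeightSystem w)
    (hwM : WeakModerate w) {χ : Fin 2 → TestFn d} (hχ : HasMDFP χ) {f : Distr d} {r : ℝ}
    (h : BoundedInGS E w {g | ∃ (j : ℕ) (l : Fin 2),
      g = ((2 : ℝ) ^ (-r * (j : ℝ))) • distrConv f (dilate j (χ l))}) :
    DistrMemGS E w f := by
  obtain ⟨L, hL⟩ := exists_nat_ge (r + 1)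
  obtain ⟨K, -, -, hK⟩ := hχ
  obtain ⟨φ, ψ, hmom, htel, hint, hφ, hψ⟩ := hK L
  set u : Fin 2 → ℕ → Rn d → ℂ := fun l j => distrConv f (dilate j (χ l))
  rw [boundedInGS_iff] at h
  have hrpow : ∀ j : ℕ, (2 : ℝ) ^ (-r * (j : ℝ)) ≠ 0 := fun j => (by positivity)
  have hinv : ∀ l j, u l j = (((2 : ℝ) ^ (r * (j : ℝ)) : ℝ) : ℂ) •
      ((2 : ℝ) ^ (-r * (j : ℝ))) • u l j := by
    intro l j
    rw [← real_smul_eq_complex_smul, smul_smul, ← Real.rpow_add two_pos]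
    simp
  have hus : ∀ l j, ContDiff ℝ ∞ (u l j) := by
    intro l j
    rw [hinv l j]
    exact contDiff_const.smul (h.1 _ ⟨j, l, rfl⟩)
  choose M hM using h.2
  have huM : ∀ (n : ℕ) (l : Fin 2) (j : ℕ), GSBound E w n ((2 : ℝ) ^ (r * (j : ℝ)) * |M n|) (u l j) := by
    intro n l j
    have h1 := ((hM n _ ⟨j, l, rfl⟩).mono (le_abs_self _)).smul (h.1 _ ⟨j, l, rfl⟩)
      (((2 : ℝ) ^ (r * (j : ℝ)) : ℝ) : ℂ)
    rw [← hinv l j, Complex.norm_real, Real.norm_of_nonneg (by positivity)] at h1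
    exact h1
  have hφ' : φ 0 = testConvolution (χ 0) (φ 0) + testConvolution (χ 1) (φ 1) := by
    ext x
    exact congrFun hφ x
  have hψ' : ψ 0 = testConvolution (χ 0) (ψ 0) + testConvolution (χ 1) (ψ 1) := by
    ext x
    exact congrFun hψ x
  have hlap : testLaplacian (ψ 0) = testConvolution (χ 0) (testLaplacian (ψ 0))
      + testConvolution (χ 1) (testLaplacian (ψ 1)) := by
    conv_lhs => rw [hψ']
    rw [testLaplacian_add, testLaplacian_testConvolution, testLaplacian_testConvolution]
  -- the partial sums `F` of the telescoping series and its terms `G`, in factorized form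
  let F : ℕ → Rn d → ℂ := fun j => distrConv f (dilate j (φ 0))
  let G : ℕ → Rn d → ℂ := fun j => u 0 j ⋆[ContinuousLinearMap.mul ℂ ℂ]
      dilate j (testLaplacian (ψ 0)) + u 1 j ⋆[ContinuousLinearMap.mul ℂ ℂ]
      dilate j (testLaplacian (ψ 1))
  have hF0 : F 0 = u 0 0 ⋆[ContinuousLinearMap.mul ℂ ℂ] dilate 0 (φ 0)
      + u 1 0 ⋆[ContinuousLinearMap.mul ℂ ℂ] dilate 0 (φ 1) := distrConv_dilate_of_eq hφ' f 0
  have hFG : ∀ j, F (j + 1) - F j = G j := by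
    intro j
    simp only [F]
    rw [← distrConv_sub, dilate_succ_sub_dilate htel]
    exact distrConv_dilate_of_eq (φ' := fun l => testLaplacian (ψ l)) hlap f j
  have hcs : ∀ l j (θ : TestFn d), ContDiff ℝ ∞ (u l j ⋆[ContinuousLinearMap.mul ℂ ℂ] θ) :=
    fun l j θ => contDiff_convolution_test (hus l j).continuous θ
  have hF0s : ContDiff ℝ ∞ (F 0) := by
    rw [hF0]
    exact (hcs _ _ _).add (hcs _ _ _)
  have hGs : ∀ j, ContDiff ℝ ∞ (G j) := fun j => (hcs _ _ _).add (hcs _ _ _)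
  -- the first term carries no gain: the only information on the moments of `φ` is `∫ φ 0 = 1`
  have hF0b : ∀ n, ∃ A, GSBound E w n A (F 0) := by
    intro n
    have hb : ∀ l, ∃ A, GSBound E w n A
        (u l 0 ⋆[ContinuousLinearMap.mul ℂ ℂ] dilate 0 (φ l)) := by
      intro l
      obtain ⟨m, C, -, hC⟩ := exists_gsBound_convolution_dilate E hw hwM n (L := 0) (ψ := φ l)
        (fun α hα => absurd hα (Nat.not_lt_zero _))
      exact ⟨_, hC (u l 0) _ (hus l 0) (huM m l 0) 0⟩
    choose A hA using hb
    rw [hF0]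
    exact ⟨_, (hA 0).add (hcs _ _ _) (hcs _ _ _) (hA 1)⟩
  have hGb : ∀ n, ∃ D, 0 ≤ D ∧ ∀ j, GSBound E w n (D * (1 / 2) ^ j) (G j) := by
    intro n
    have hb : ∀ l, ∃ D, 0 ≤ D ∧ ∀ j, GSBound E w n (D * (1 / 2) ^ j)
        (u l j ⋆[ContinuousLinearMap.mul ℂ ℂ] dilate j (testLaplacian (ψ l))) := by
      intro l
      obtain ⟨m, C, hC0, hC⟩ := exists_gsBound_convolution_dilate_testLaplacian E hw hwM n
        (hmom l).2.2.1
      refine ⟨C * |M m|, by positivity, fun j => ?_⟩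
      refine (hC (u l j) _ (hus l j) (huM m l j) j).mono ?_
      calc C * ((2 : ℝ) ^ j)⁻¹ ^ L * ((2 : ℝ) ^ (r * (j : ℝ)) * |M m|)
          = C * |M m| * (((2 : ℝ) ^ j)⁻¹ ^ L * (2 : ℝ) ^ (r * (j : ℝ))) := by ring
        _ ≤ C * |M m| * (1 / 2) ^ j := by
            gcongr
            exact inv_two_pow_mul_rpow_le hL j
    choose D hD0 hD using hb
    refine ⟨D 0 + D 1, add_nonneg (hD0 0) (hD0 1), fun j => ?_⟩
    rw [add_mul]
    exact (hD 0 j).add (hcs _ _ _) (hcs _ _ _) (hD 1 j)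
  choose A hA using hF0b
  choose D hD0 hD using hGb
  -- the first term is put in front, so that the sum over `range (N + 1)` telescopes to `F N`
  let T : ℕ → Rn d → ℂ := fun j => Nat.casesOn j (F 0) G
  have hTsum : ∀ N, (fun x => ∑ j ∈ Finset.range (N + 1), T j x) = F N := by
    intro N
    induction N with
    | zero => ext x; simp [T]
    | succ N ih =>
      ext x
      rw [Finset.sum_range_succ, congrFun ih x]
      have := congrFun (hFG N) x
      rw [Pi.sub_apply] at this
      change F N x + G N x = _
      rw [← this]
      ring
  obtain ⟨hmem, hunif⟩ := exists_sum_of_summable_gsBound hw (G := T)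
    (c := fun n j => (A n + 2 * D n) * (1 / 2) ^ j) (E := E)
    (fun j => by cases j with
      | zero => exact hF0s
      | succ j => exact hGs j)
    (fun n => (summable_geometric_of_lt_one (by norm_num) (by norm_num)).mul_left _)
    (fun n j => by
      have hA0 := (hA n).nonneg
      have hD0 := hD0 n
      cases j with
      | zero => exact (hA n).mono (by linarith)
      | succ j =>
        refine (hD n j).mono ?_
        rw [pow_succ]
        have : (0 : ℝ) ≤ A n * (1 / 2) ^ j := by positivity
        linarith)
  refine ⟨_, hmem, fun η => ?_⟩
  set g : Rn d → ℂ := fun x => ∑' j, T j x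
  have hgc : Continuous g := (mem_gelfandShilov_iff.1 hmem).1.continuous
  have hunif' : TendstoUniformly F g Filter.atTop := by
    intro v hv
    filter_upwards [(Filter.tendsto_add_atTop_nat 1).eventually (hunif v hv)] with N hN x
    rw [← congrFun (hTsum N) x]
    exact hN x
  refine tendsto_nhds_unique (tendsto_integral_distrConv_dilate f (φ 0) η hint) ?_
  refine tendsto_integral_filter_of_dominated_convergence (fun x => (‖g x‖ + 1) * ‖η x‖) ?_ ?_ ?_ ?_
  · refine Filter.Eventually.of_forall fun j => ?_
    exact ((continuous_distrConv f _).mul η.continuous).aestronglyMeasurable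
  · filter_upwards [Metric.tendstoUniformly_iff.1 hunif' 1 one_pos] with j hj
    refine Filter.Eventually.of_forall fun x => ?_
    rw [norm_mul]
    gcongr
    have h1 := hj x
    rw [dist_eq_norm'] at h1
    change ‖F j x‖ ≤ _
    have h2 : ‖F j x‖ ≤ ‖g x‖ + ‖F j x - g x‖ := by
      have := norm_add_le (g x) (F j x - g x)
      rwa [add_sub_cancel] at this
    linarith
  · exact Continuous.integrable_of_hasCompactSupport
      ((hgc.norm.add continuous_const).mul η.continuous.norm)
      η.hasCompactSupport.norm.mul_left
  · exact Filter.Eventually.of_forall fun x => (hunif'.tendsto_at x).mul_const _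

end Conditions

end

theorem theoremt {d : ℕ} {B : Type*} [NormedAddCommGroup B] [NormedSpace ℂ B] [CompleteSpace B]
    (E : SolidTIBF d B) (w : ℕ → Rn d → ℝ) (hw : IsWeightSystem w) (hwM : WeakModerate w)
    (χ : Fin 2 → TestFn d) (hχ : HasMDFP χ) (f : Distr d) :
    List.TFAE [
      DistrMemGS E w f,
      ∀ φ : TestFn d, BoundedInGS E w {g | ∃ j : ℕ, g = distrConv f (dilate j φ)},
      ∀ φ : TestFn d, ∃ r : ℝ, 0 < r ∧
        BoundedInGS E w
          {g | ∃ j : ℕ, g = ((2 : ℝ) ^ (-r * (j : ℝ))) • distrConv f (dilate j φ)},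
      ∃ r : ℝ, 0 < r ∧
        BoundedInGS E w
          {g | ∃ (j : ℕ) (l : Fin 2),
            g = ((2 : ℝ) ^ (-r * (j : ℝ))) • distrConv f (dilate j (χ l))}] := by
  tfae_have 1 → 2 := fun h φ => boundedInGS_of_distrMemGS hw hwM h φ
  tfae_have 2 → 3 := fun h φ => ⟨1, one_pos, boundedInGS_rpow_smul one_pos (h φ)⟩
  tfae_have 3 → 4 := by
    intro h
    choose r hr hb using fun l => h (χ l)
    exact ⟨r 0 + r 1, add_pos (hr 0) (hr 1),
      boundedInGS_rpow_smul_add (v := fun l j => distrConv f (dilate j (χ l))) hr hb⟩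
  tfae_have 4 → 1 := fun ⟨_, _, h⟩ => distrMemGS_of_boundedInGS hw hwM hχ h
  tfae_finish
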